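/- Let $K>0$ and $0<c<C$. There are constants $C_0,C_1>0$, depending only on $K,c,C$, such that the following holds for every integer $n\ge 1$. Let $X=(x_{ij})_{i,j=1}^n$ be a random matrix with independent (real or complex, not necessarily identically or symmetrically distributed) entries satisfying $\mathbb{E}[x_{ij}]=0$, $\mathbb{E}[|x_{ij}|^2]=1$ and the sub-exponential moment bounds $\mathbb{E}[|x_{ij}|^m]\le (Km)^m$ for all integers $m\ge1$ and all $i,j$. Let $b_{ij}\ge 0$ $(1\le i,j\le n)$ be deterministic with $\frac{c}{n}\le b_{ij}^2\le \frac{C}{n}$ for all $i,j$, and put $A=(b_{ij}x_{ij})_{i,j=1}^n$ and $S=(b_{ij}^2)_{i,j=1}^n$. Then, writing $\rho(\cdot)$ for the spectral radius, for every $t>0$, $$\mathbb{P}\left(\rho(A)\ge \sqrt{\rho(S)}+\frac{t}{\sqrt n}\right)\le C_0\,n^2e^{-C_1t}.$$ -/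

import Mathlib

open MeasureTheory ProbabilityTheory

/-- The entries of the random `n × n` matrix `X` are independent, centred, of unit variance, and
sub-exponential with constant `K`: `𝔼|x_ij|^m ≤ (K m)^m` for every integer `m ≥ 1`. The entries are
complex-valued (real entries are a special case); their laws may differ from entry to entry and
need not be symmetric. -/
structure IsSubexponentialModel {n : ℕ} {Ω : Type*} [MeasurableSpace Ω] (μ : Measure Ω) (K : ℝ)
    (X : Ω → Matrix (Fin n) (Fin n) ℂ) : Prop where
  measurable_entry : ∀ i j, Measurable fun ω => X ω i j
  indep : iIndepFun (fun (p : Fin n × Fin n) (ω : Ω) => X ω p.1 p.2) μ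
  mean_zero : ∀ i j, ∫ ω, X ω i j ∂μ = 0
  second_moment : ∀ i j, ∫ ω, ‖X ω i j‖ ^ 2 ∂μ = 1
  integrable_moment : ∀ i j, ∀ m : ℕ, 1 ≤ m → Integrable (fun ω => ‖X ω i j‖ ^ m) μ
  moment_le : ∀ i j, ∀ m : ℕ, 1 ≤ m → ∫ ω, ‖X ω i j‖ ^ m ∂μ ≤ (K * m) ^ m

/-- The inhomogeneous random matrix `A = (b_ij x_ij)`. -/
def inhomogeneousMatrix {n : ℕ} {Ω : Type*} (b : Matrix (Fin n) (Fin n) ℝ)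
    (X : Ω → Matrix (Fin n) (Fin n) ℂ) (ω : Ω) : Matrix (Fin n) (Fin n) ℂ :=
  Matrix.of fun i j => (b i j : ℂ) * X ω i j

/-- The variance matrix `S = (b_ij ^ 2)`. -/
def varianceMatrix {n : ℕ} (b : Matrix (Fin n) (Fin n) ℝ) : Matrix (Fin n) (Fin n) ℝ :=
  Matrix.of fun i j => b i j ^ 2

/-- The spectral radius of a complex square matrix, the largest modulus of its (complex)
eigenvalues, as a real number. -/
noncomputable def matrixSpectralRadius {n : ℕ} (M : Matrix (Fin n) (Fin n) ℂ) : ℝ :=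
  (spectralRadius ℂ M).toReal

/-- The value of `spectralRadius` on a matrix is finite, so that no information is lost by
`ENNReal.toReal` in `matrixSpectralRadius`. -/
theorem spectralRadius_matrix_ne_top {n : ℕ} (M : Matrix (Fin n) (Fin n) ℂ) :
    spectralRadius ℂ M ≠ ⊤ := by
  have hfin : (spectrum ℂ M).Finite := Matrix.finite_spectrum M
  obtain ⟨B, hB⟩ := (hfin.image fun k => ‖k‖₊).bddAbove
  refine ne_top_of_le_ne_top (ENNReal.coe_ne_top (r := B)) ?_
  refine iSup₂_le fun k hk => ?_
  exact_mod_cast hB ⟨k, hk, rfl⟩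

/-- The spectral radius of a real square matrix, that is, of the same matrix seen as a complex
one. -/
noncomputable def realMatrixSpectralRadius {n : ℕ} (M : Matrix (Fin n) (Fin n) ℝ) : ℝ :=
  matrixSpectralRadius (M.map Complex.ofReal)

/-! The proof is the moment method applied to a conjugated matrix. For R > √ρ(S), a truncated
resolvent series applied to the all-ones vector gives x > 0 with Sx ≤ R²x, and the flatness of S
makes the entries of x comparable (`exists_subinvariant_vector`). Conjugating A by diag(√x) and
dividing by R yields A' with spectral radius ρ(A)/R, whose variance matrix has row sums at most 1
and entries of order 1/(nR²). By `integral_frobenius_pow_le`, E‖A'^k‖_F² is O(nk) as long as k is at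
most a small multiple of √n R. Markov's inequality with k of this order gives the tail.

The second moment of A'^k is a sum over pairs of walks with common end points. By independence and
centring, only pairs that use no edge exactly once in total survive. As the laws need not be
symmetric, odd multiplicities from 3 on do contribute. The core is a comparison with single walks
(`sum_pairs_le_sum_walks`). At most ∏ d(x)! / ∏ m(e)! pairs have joint edge multiplicities m, with d
the out-degrees. An Eulerian orientation of the odd edges tells which halves m(e)/2 to round up and
which down, so that the result α is a connected flow of one walk. A lower bound in the spirit of the
BEST theorem says that at least ∏ (d(x)-1)! / ∏ α(e)! walks realise α.

What remains is a sum over single walks, weighted by variances and by penalties for repeated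
vertices and edges. It is summed one step at a time (`sum_walkWeight_add_le`): fresh vertices
contribute at most a row sum times 1 + O(1/k), and all returns together contribute O(1/k). Over at
most 2k steps this stays bounded. -/

set_option linter.unusedSectionVars false

/-! ### Walks, edge multiplicities, and an upper bound for the number of walks -/

/-- Sequences of `k` vertices, the steps of a walk of length `k` whose start is given separately. -/
@[reducible] def VertexSeq (V : Type) : ℕ → Type
  | 0 => Unit
  | k + 1 => V × VertexSeq V k

instance VertexSeq.instFintype (V : Type) [Fintype V] : ∀ k, Fintype (VertexSeq V k)
  | 0 => inferInstanceAs (Fintype Unit)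
  | k + 1 =>
    haveI := VertexSeq.instFintype V k
    inferInstanceAs (Fintype (V × VertexSeq V k))

section Walks

open scoped Nat Classical

variable {V : Type} [Fintype V] [DecidableEq V]

theorem VertexSeq.sum_zero {M : Type*} [AddCommMonoid M] (f : VertexSeq V 0 → M) :
    ∑ p, f p = f () := by
  exact Fintype.sum_unique (ι := Unit) f

theorem VertexSeq.sum_succ {M : Type*} [AddCommMonoid M] {k : ℕ} (f : VertexSeq V (k + 1) → M) :
    ∑ p, f p = ∑ z : V, ∑ p : VertexSeq V k, f (z, p) := by
  exact Fintype.sum_prod_type (α₁ := V) (α₂ := VertexSeq V k) f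

/-- The number of times the walk from `u` along `p` uses each directed edge. -/
def edgeCount : ∀ {k : ℕ}, V → VertexSeq V k → V × V → ℕ
  | 0, _, _ => 0
  | _ + 1, u, (z, p) => Pi.single (u, z) 1 + edgeCount z p

/-- The last vertex of the walk from `u` along `p`. -/
def lastVertex : ∀ {k : ℕ}, V → VertexSeq V k → V
  | 0, u, _ => u
  | _ + 1, _, (z, p) => lastVertex z p

/-- Out-degree in a directed multigraph given by edge multiplicities. -/
def outDeg (m : V × V → ℕ) (x : V) : ℕ := ∑ z, m (x, z)

/-- In-degree in a directed multigraph given by edge multiplicities. -/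
def inDeg (m : V × V → ℕ) (x : V) : ℕ := ∑ z, m (z, x)

theorem outDeg_add (m m' : V × V → ℕ) (x : V) : outDeg (m + m') x = outDeg m x + outDeg m' x := by
  simp [outDeg, Finset.sum_add_distrib]

theorem inDeg_add (m m' : V × V → ℕ) (x : V) : inDeg (m + m') x = inDeg m x + inDeg m' x := by
  simp [inDeg, Finset.sum_add_distrib]

theorem outDeg_single (u z x : V) :
    outDeg (Pi.single (u, z) 1 : V × V → ℕ) x = (Pi.single u 1 : V → ℕ) x := by
  simp only [outDeg, Pi.single_apply, Prod.mk.injEq]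
  by_cases h : x = u <;> simp [h]

theorem inDeg_single (u z x : V) :
    inDeg (Pi.single (u, z) 1 : V × V → ℕ) x = (Pi.single z 1 : V → ℕ) x := by
  simp only [inDeg, Pi.single_apply, Prod.mk.injEq]
  by_cases h : x = z <;> simp [h]

theorem outDeg_add_single (m : V × V → ℕ) (u z : V) :
    outDeg (m + Pi.single (u, z) 1) = outDeg m + Pi.single u 1 := by
  funext x
  rw [outDeg_add, outDeg_single, Pi.add_apply]

theorem inDeg_add_single (m : V × V → ℕ) (u z : V) :
    inDeg (m + Pi.single (u, z) 1) = inDeg m + Pi.single z 1 := by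
  funext x
  rw [inDeg_add, inDeg_single, Pi.add_apply]

theorem sum_outDeg (m : V × V → ℕ) : ∑ x, outDeg m x = ∑ e, m e := by
  simp [outDeg, Fintype.sum_prod_type]

theorem le_outDeg (m : V × V → ℕ) (x z : V) : m (x, z) ≤ outDeg m x :=
  Finset.single_le_sum (f := fun z => m (x, z)) (fun _ _ => Nat.zero_le _) (Finset.mem_univ z)

theorem outDeg_pos_iff (m : V × V → ℕ) (x : V) : 0 < outDeg m x ↔ ∃ z, 0 < m (x, z) := by
  simp [outDeg, Finset.sum_pos_iff]

theorem prod_add_single {ι : Type*} [Fintype ι] [DecidableEq ι] (F : ℕ → ℝ) (f : ι → ℕ) (i : ι) :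
    (∏ j, F ((f + Pi.single i 1 : ι → ℕ) j)) * F (f i) = (∏ j, F (f j)) * F (f i + 1) := by
  rw [← Finset.mul_prod_erase Finset.univ _ (Finset.mem_univ i),
    ← Finset.mul_prod_erase Finset.univ (fun j => F (f j)) (Finset.mem_univ i)]
  have : ∏ j ∈ Finset.univ.erase i, F ((f + Pi.single i 1 : ι → ℕ) j)
      = ∏ j ∈ Finset.univ.erase i, F (f j) := by
    refine Finset.prod_congr rfl fun j hj => ?_
    simp [(Finset.ne_of_mem_erase hj)]
  rw [this]
  simp only [Pi.add_apply, Pi.single_eq_same]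
  ring

theorem sum_edgeCount : ∀ {k : ℕ} (u : V) (p : VertexSeq V k), ∑ e, edgeCount u p e = k
  | 0, _, _ => by simp [edgeCount]
  | k + 1, u, (z, p) => by
    simp [edgeCount, Finset.sum_add_distrib, sum_edgeCount z p, add_comm]

/-- Flow conservation along a walk. -/
theorem outDeg_edgeCount_add : ∀ {k : ℕ} (u : V) (p : VertexSeq V k) (x : V),
    outDeg (edgeCount u p) x + (Pi.single (lastVertex u p) 1 : V → ℕ) x
      = inDeg (edgeCount u p) x + (Pi.single u 1 : V → ℕ) x
  | 0, u, p, x => by simp [edgeCount, lastVertex, outDeg, inDeg]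
  | k + 1, u, (z, p), x => by
    have := outDeg_edgeCount_add z p x
    simp only [edgeCount, lastVertex, outDeg_add, inDeg_add, outDeg_single, inDeg_single]
    omega

theorem reachable_of_edgeCount_pos : ∀ {k : ℕ} (u : V) (p : VertexSeq V k) (m : V × V → ℕ),
    edgeCount u p ≤ m → ∀ x, 0 < outDeg (edgeCount u p) x →
      Relation.ReflTransGen (fun a b => 0 < m (a, b)) u x
  | 0, u, p, m, _, x, h => by simp [edgeCount, outDeg] at h
  | k + 1, u, (z, p), m, hm, x, h => by
    by_cases hx : x = u
    · subst hx; exact Relation.ReflTransGen.refl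
    have h1 : 0 < m (u, z) := by
      have := hm (u, z)
      simp [edgeCount] at this
      omega
    have h2 : edgeCount z p ≤ m := fun e => le_trans (by simp [edgeCount]) (hm e)
    have h3 : 0 < outDeg (edgeCount z p) x := by
      simpa [edgeCount, outDeg_add, outDeg_single, Pi.single_apply, hx] using h
    exact Relation.ReflTransGen.head h1 (reachable_of_edgeCount_pos z p m h2 x h3)

/-- The number of systems of orders in which the edges at all vertices can be left, for given edge
multiplicities. It bounds the number of walks with these multiplicities. -/
noncomputable def departureOrders (m : V × V → ℕ) : ℝ :=
  (∏ x, ((outDeg m x)! : ℝ)) / ∏ e, ((m e)! : ℝ)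

theorem departureOrders_nonneg (m : V × V → ℕ) : 0 ≤ departureOrders m := by
  unfold departureOrders; positivity

theorem departureOrders_add_single (m : V × V → ℕ) (u z : V) :
    departureOrders m * (outDeg m u + 1)
      = departureOrders (m + Pi.single (u, z) 1) * (m (u, z) + 1) := by
  unfold departureOrders
  rw [outDeg_add_single]
  have h1 := prod_add_single (fun a => ((a ! : ℕ) : ℝ)) (outDeg m) u
  have h2 := prod_add_single (fun a => ((a ! : ℕ) : ℝ)) m (u, z)
  simp only [Nat.factorial_succ, Nat.cast_mul, Nat.cast_add, Nat.cast_one] at h1 h2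
  have p1 : ((outDeg m u)! : ℝ) ≠ 0 := by positivity
  have p2 : ((m (u, z))! : ℝ) ≠ 0 := by positivity
  have p3 : (∏ e, ((m e)! : ℝ)) ≠ 0 := by positivity
  have h1' : (∏ j, (((outDeg m + Pi.single u 1 : V → ℕ) j)! : ℝ))
      = (∏ j, ((outDeg m j)! : ℝ)) * (outDeg m u + 1) := by
    apply mul_right_cancel₀ p1; rw [h1]; ring
  have h2' : (∏ j, (((m + Pi.single (u, z) 1 : V × V → ℕ) j)! : ℝ))
      = (∏ j, ((m j)! : ℝ)) * (m (u, z) + 1) := by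
    apply mul_right_cancel₀ p2; rw [h2]; ring
  rw [h1', h2']
  field_simp

/-- The first departure from `u` goes to `z` in a share `m (u, z) / outDeg m u` of all orders, and
these shares add up to one. If nothing leaves `u`, every term is zero. -/
theorem sum_departureOrders_sub_le (m : V × V → ℕ) (u : V) :
    ∑ z, (if (Pi.single (u, z) 1 : V × V → ℕ) ≤ m
      then departureOrders (m - Pi.single (u, z) 1) else 0) ≤ departureOrders m := by
  rcases Nat.eq_zero_or_pos (outDeg m u) with h0 | h0
  · have : ∀ z, ¬ (Pi.single (u, z) 1 : V × V → ℕ) ≤ m := by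
      intro z hz
      have h1 := hz (u, z)
      have h2 := le_outDeg m u z
      simp at h1; omega
    simp [this, departureOrders_nonneg]
  have key : ∀ z, (if (Pi.single (u, z) 1 : V × V → ℕ) ≤ m
      then departureOrders (m - Pi.single (u, z) 1) else 0)
        ≤ departureOrders m * (m (u, z) / outDeg m u) := by
    intro z
    have hpos : (0 : ℝ) < outDeg m u := by exact_mod_cast h0
    split_ifs with hz
    · obtain ⟨m', rfl⟩ : ∃ m', m = m' + Pi.single (u, z) 1 := ⟨m - Pi.single (u, z) 1, by
        rw [tsub_add_cancel_of_le hz]⟩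
      rw [add_tsub_cancel_right]
      have := departureOrders_add_single m' u z
      rw [outDeg_add_single] at hpos ⊢
      simp only [Pi.add_apply, Pi.single_eq_same, Nat.cast_add, Nat.cast_one] at hpos ⊢
      rw [← mul_div_assoc, ← this, mul_div_assoc, div_self hpos.ne', mul_one]
    · have := departureOrders_nonneg m; positivity
  refine (Finset.sum_le_sum fun z _ => key z).trans ?_
  rw [← Finset.mul_sum, ← Finset.sum_div]
  have : (∑ z, (m (u, z) : ℝ)) = outDeg m u := by simp [outDeg]
  rw [this, div_self (by positivity), mul_one]

/-- Here `f` bounds the ways to use up the edges left over by the walk. The indicator of zero counts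
single walks; the count of second walks gives pairs. -/
theorem sum_edgeCount_le_departureOrders (f : (V × V → ℕ) → ℝ) (hf : ∀ m, f m ≤ departureOrders m) :
    ∀ (k : ℕ) (u : V) (m : V × V → ℕ),
      ∑ p : VertexSeq V k, (if edgeCount u p ≤ m then f (m - edgeCount u p) else 0)
        ≤ departureOrders m
  | 0, u, m => by
    rw [VertexSeq.sum_zero]
    have : (0 : V × V → ℕ) ≤ m := fun _ => Nat.zero_le _
    simpa [edgeCount, this] using hf m
  | k + 1, u, m => by
    rw [VertexSeq.sum_succ]
    refine le_trans (Finset.sum_le_sum fun z _ => ?_) (sum_departureOrders_sub_le m u)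
    split_ifs with hz
    · refine le_trans (le_of_eq ?_)
        (sum_edgeCount_le_departureOrders f hf k z (m - Pi.single (u, z) 1))
      refine Finset.sum_congr rfl fun p _ => ?_
      simp only [edgeCount]
      have : Pi.single (u, z) 1 + edgeCount z p ≤ m ↔ edgeCount z p ≤ m - Pi.single (u, z) 1 := by
        rw [le_tsub_iff_left hz]
      simp only [this, tsub_add_eq_tsub_tsub]
    · refine le_of_eq (Finset.sum_eq_zero fun p _ => ?_)
      rw [if_neg]
      intro h
      exact hz (le_trans (by simp [edgeCount]) h)

theorem sum_edgeCount_eq_le (k : ℕ) (u : V) (m : V × V → ℕ) :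
    ∑ p : VertexSeq V k, (if edgeCount u p = m then (1 : ℝ) else 0) ≤ departureOrders m := by
  refine le_trans (le_of_eq ?_) (sum_edgeCount_le_departureOrders
    (fun m => if m = 0 then (1 : ℝ) else 0) (fun m => ?_) k u m)
  · refine Finset.sum_congr rfl fun p _ => ?_
    by_cases h : edgeCount u p = m
    · simp [h]
    · by_cases h' : edgeCount u p ≤ m
      · have : ¬ (m - edgeCount u p = 0) := by
          rw [tsub_eq_zero_iff_le]; exact fun h'' => h (le_antisymm h' h'')
        simp [h, this]
      · simp [h, h']
  · split_ifs with h
    · subst h; simp [departureOrders, outDeg]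
    · exact departureOrders_nonneg m

theorem sum_pair_edgeCount_eq_le (j k : ℕ) (u v : V) (m : V × V → ℕ) :
    ∑ p : VertexSeq V j, ∑ q : VertexSeq V k,
      (if edgeCount u p + edgeCount v q = m then (1 : ℝ) else 0) ≤ departureOrders m := by
  refine le_trans (le_of_eq ?_) (sum_edgeCount_le_departureOrders
    (fun m => ∑ q : VertexSeq V k, (if edgeCount v q = m then (1 : ℝ) else 0))
      (fun m => sum_edgeCount_eq_le k v m) j u m)
  refine Finset.sum_congr rfl fun p _ => ?_
  split_ifs with h
  · refine Finset.sum_congr rfl fun q _ => ?_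
    simp only [eq_tsub_iff_add_eq_of_le h, add_comm]
  · refine Finset.sum_eq_zero fun q _ => ?_
    rw [if_neg]
    rintro rfl
    exact h (by simp)

end Walks

/-! ### A lower bound for the number of walks with given multiplicities -/

section Trails

open scoped Nat Classical

variable {V : Type} [Fintype V] [DecidableEq V]

/-- Unit flow conservation from `y` to `v`. -/
def IsPathFlow (m : V × V → ℕ) (y v : V) : Prop :=
  ∀ x, outDeg m x + (Pi.single v 1 : V → ℕ) x = inDeg m x + (Pi.single y 1 : V → ℕ) x

/-- Reachability along edges of positive multiplicity. -/
def Reaches (m : V × V → ℕ) : V → V → Prop := Relation.ReflTransGen fun a b => 0 < m (a, b)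

/-- Every edge of positive multiplicity can be reached from `y`. -/
def SpannedFrom (m : V × V → ℕ) (y : V) : Prop := ∀ x, 0 < outDeg m x → Reaches m y x

theorem IsPathFlow.of_add_single {m : V × V → ℕ} {y z v : V}
    (h : IsPathFlow (m + Pi.single (y, z) 1) y v) : IsPathFlow m z v := by
  intro x
  have := h x
  rw [outDeg_add, inDeg_add, outDeg_single, inDeg_single] at this
  omega

/-- No edge leaves the set U of vertices reachable from `z`. Summing the conservation law over U
therefore leaves [v ∈ U] = 1 + (inflow into U), which forces v ∈ U and zero inflow. -/
theorem IsPathFlow.no_inflow {m : V × V → ℕ} {z v : V} (h : IsPathFlow m z v) :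
    Reaches m z v ∧ ∀ a b, ¬ Reaches m z a → Reaches m z b → m (a, b) = 0 := by
  set U : Finset V := Finset.univ.filter (Reaches m z) with hU
  have memU : ∀ x, x ∈ U ↔ Reaches m z x := fun x => by simp [hU]
  have hout : ∑ x ∈ U, outDeg m x = ∑ x ∈ U, ∑ a ∈ U, m (x, a) := by
    refine Finset.sum_congr rfl fun x hx => ?_
    unfold outDeg
    refine (Finset.sum_subset (Finset.subset_univ U) fun a _ ha => ?_).symm
    by_contra hne
    exact ha ((memU a).2 (Relation.ReflTransGen.tail ((memU x).1 hx) (Nat.pos_of_ne_zero hne)))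
  have hin : ∑ x ∈ U, inDeg m x
      = ∑ x ∈ U, ∑ a ∈ U, m (a, x) + ∑ x ∈ U, ∑ a ∈ Uᶜ, m (a, x) := by
    rw [← Finset.sum_add_distrib]
    exact Finset.sum_congr rfl fun x _ => (Finset.sum_add_sum_compl U _).symm
  have hsum : ∑ x ∈ U, (outDeg m x + (Pi.single v 1 : V → ℕ) x)
      = ∑ x ∈ U, (inDeg m x + (Pi.single z 1 : V → ℕ) x) := Finset.sum_congr rfl fun x _ => h x
  have hz : z ∈ U := (memU z).2 Relation.ReflTransGen.refl
  rw [Finset.sum_add_distrib, Finset.sum_add_distrib, hout, hin, Finset.sum_pi_single',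
    Finset.sum_pi_single', if_pos hz, Finset.sum_comm] at hsum
  have hv : v ∈ U := by
    by_contra hv
    rw [if_neg hv] at hsum
    omega
  rw [if_pos hv] at hsum
  refine ⟨(memU v).1 hv, fun a b ha hb => ?_⟩
  have h0 : ∑ x ∈ U, ∑ a ∈ Uᶜ, m (a, x) = 0 := by omega
  rw [Finset.sum_eq_zero_iff] at h0
  have h1 := h0 b ((memU b).2 hb)
  rw [Finset.sum_eq_zero_iff] at h1
  exact h1 a (by simpa [memU] using ha)

/-- The deleted edge leads to `z`, so whatever `y` reached is `y` itself or is reached from `z`. The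
vertex `y` needs the extra hypothesis. -/
theorem SpannedFrom.of_add_single {m : V × V → ℕ} {y z : V}
    (h : SpannedFrom (m + Pi.single (y, z) 1) y) (hy : Reaches m z y ∨ outDeg m y = 0) :
    SpannedFrom m z := by
  intro x hx
  have hx' : Reaches (m + Pi.single (y, z) 1) y x := h x (by rw [outDeg_add]; omega)
  have key : ∀ w, Reaches (m + Pi.single (y, z) 1) y w → w = y ∨ Reaches m z w := by
    intro w hw
    induction hw with
    | refl => exact Or.inl rfl
    | tail hab hbc ih =>
      rename_i b w
      by_cases hpos : 0 < m (b, w)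
      · rcases ih with rfl | ih
        · rcases hy with hy | hy
          · exact Or.inr (hy.tail hpos)
          · have := le_outDeg m b w; omega
        · exact Or.inr (ih.tail hpos)
      · have : b = y ∧ w = z := by
          by_contra hne
          rw [Pi.add_apply, Pi.single_eq_of_ne (by simpa using hne)] at hbc
          omega
        exact Or.inr (this.2 ▸ Relation.ReflTransGen.refl)
  rcases key x hx' with rfl | hr
  · rcases hy with hy | hy
    · exact hy
    · omega
  · exact hr

/-- A first step from which `y` cannot be regained uses a bridge; by `no_inflow` no second copy of
that edge exists. For two distinct bridges, the sets reachable behind them would be disjoint, yet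
both contain the end point `v`. -/
theorem not_two_bridges {m m₁ m₂ : V × V → ℕ} {y z₁ z₂ v : V}
    (h1 : m = m₁ + Pi.single (y, z₁) 1) (h2 : m = m₂ + Pi.single (y, z₂) 1)
    (hm : IsPathFlow m y v) (b1 : ¬ Reaches m₁ z₁ y) (b2 : ¬ Reaches m₂ z₂ y) :
    z₁ = z₂ ∧ m (y, z₁) = 1 := by
  have f1 : IsPathFlow m₁ z₁ v := (h1 ▸ hm).of_add_single
  have f2 : IsPathFlow m₂ z₂ v := (h2 ▸ hm).of_add_single
  have c1 := f1.no_inflow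
  have c2 := f2.no_inflow
  have e1 : m₁ (y, z₁) = 0 := c1.2 y z₁ b1 Relation.ReflTransGen.refl
  have e : m (y, z₁) = 1 := by rw [h1]; simp [e1]
  refine ⟨?_, e⟩
  by_contra hne
  have g1 : ¬ Reaches m₂ z₂ z₁ := by
    intro hr
    have := c2.2 y z₁ b2 hr
    rw [h2, Pi.add_apply, this, Pi.single_eq_of_ne (by simpa using hne)] at e
    omega
  have key : ∀ w, Reaches m₁ z₁ w → ¬ Reaches m₂ z₂ w := by
    intro w hw
    induction hw with
    | refl => exact g1
    | tail hab hbc ih =>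
      rename_i b w
      intro hr
      have hby : b ≠ y := fun hb => b1 (hb ▸ hab)
      have h0 := c2.2 b w ih hr
      have : m (b, w) = m₂ (b, w) := by
        rw [h2, Pi.add_apply, Pi.single_eq_of_ne (by simp [hby])]; rfl
      have h3 : m (b, w) = m₁ (b, w) := by
        rw [h1, Pi.add_apply, Pi.single_eq_of_ne (by simp [hby])]; rfl
      omega
  exact key v c1.1 c2.1

/-- A lower bound for the number of walks with given edge multiplicities. -/
noncomputable def trailLowerBound (m : V × V → ℕ) : ℝ :=
  (∏ x, ((outDeg m x - 1)! : ℝ)) / ∏ e, ((m e)! : ℝ)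

theorem trailLowerBound_pos (m : V × V → ℕ) : 0 < trailLowerBound m := by
  unfold trailLowerBound; positivity

/-- With truncated subtraction the quotient of factorials is the old out-degree of `y` if that is
positive, and 1 otherwise. -/
theorem trailLowerBound_add_single (m : V × V → ℕ) (y z : V) :
    trailLowerBound m * ((outDeg m y + 1 - 1 : ℕ)! / (outDeg m y - 1)!)
      = trailLowerBound (m + Pi.single (y, z) 1) * (m (y, z) + 1) := by
  unfold trailLowerBound
  rw [outDeg_add_single]
  have h1 := prod_add_single (fun a => (((a - 1)! : ℕ) : ℝ)) (outDeg m) y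
  have h2 := prod_add_single (fun a => ((a ! : ℕ) : ℝ)) m (y, z)
  simp only [Nat.factorial_succ, Nat.cast_mul, Nat.cast_add, Nat.cast_one] at h2
  have p1 : ((outDeg m y - 1)! : ℝ) ≠ 0 := by positivity
  have p2 : ((m (y, z))! : ℝ) ≠ 0 := by positivity
  have p3 : (∏ e, ((m e)! : ℝ)) ≠ 0 := by positivity
  have h1' : (∏ j, (((outDeg m + Pi.single y 1 : V → ℕ) j - 1)! : ℝ))
      = (∏ j, ((outDeg m j - 1)! : ℝ)) * ((outDeg m y + 1 - 1)! / (outDeg m y - 1)!) := by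
    apply mul_right_cancel₀ p1; rw [h1]; field_simp
  have h2' : (∏ j, (((m + Pi.single (y, z) 1 : V × V → ℕ) j)! : ℝ))
      = (∏ j, ((m j)! : ℝ)) * (m (y, z) + 1) := by
    apply mul_right_cancel₀ p2; rw [h2]; ring
  rw [h1', h2']
  field_simp

/-- This is Fleury's algorithm, counted. A single remaining edge at `y` may always be taken. For
out-degree d ≥ 2, taking an edge to `z` multiplies the bound by m(y,z)/(d-1); at most one of the d
departures is a forbidden bridge, so the admissible factors add up to at least 1. -/
theorem sum_sub_one_le {m : V × V → ℕ} {y v : V} (hm : IsPathFlow m y v) (hs : SpannedFrom m y)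
    (hpos : 0 < outDeg m y) :
    trailLowerBound m ≤ ∑ z, if (Pi.single (y, z) 1 ≤ m ∧ SpannedFrom (m - Pi.single (y, z) 1) z)
      then trailLowerBound (m - Pi.single (y, z) 1 : V × V → ℕ) else 0 := by
  have hle : ∀ z, 0 < m (y, z) → (Pi.single (y, z) 1 : V × V → ℕ) ≤ m := by
    intro z hz e
    by_cases he : e = (y, z)
    · subst he; simpa [Nat.one_le_iff_ne_zero, Nat.pos_iff_ne_zero] using hz
    · simp [Pi.single_eq_of_ne he]
  have hdec : ∀ z, 0 < m (y, z) → m = (m - Pi.single (y, z) 1) + Pi.single (y, z) 1 :=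
    fun z hz => (tsub_add_cancel_of_le (hle z hz)).symm
  have hdeg : ∀ z, 0 < m (y, z) → outDeg (m - Pi.single (y, z) 1) y + 1 = outDeg m y := by
    intro z hz
    conv_rhs => rw [hdec z hz, outDeg_add, outDeg_single, Pi.single_eq_same]
  by_cases h1 : outDeg m y = 1
  · obtain ⟨z, hz⟩ := (outDeg_pos_iff m y).1 hpos
    have hd := hdeg z hz
    have hd0 : outDeg (m - Pi.single (y, z) 1) y = 0 := by omega
    have hsp : SpannedFrom (m - Pi.single (y, z) 1) z :=
      SpannedFrom.of_add_single (by rw [← hdec z hz]; exact hs) (Or.inr hd0)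
    have hmz : m (y, z) = 1 := by have := le_outDeg m y z; omega
    have hR := trailLowerBound_add_single (m - Pi.single (y, z) 1) y z
    rw [← hdec z hz, hd0] at hR
    have : (m - Pi.single (y, z) 1 : V × V → ℕ) (y, z) = 0 := by simp [hmz]
    rw [this] at hR
    simp at hR
    refine le_trans (le_of_eq ?_) (Finset.single_le_sum
      (f := fun z => if (Pi.single (y, z) 1 ≤ m ∧ SpannedFrom (m - Pi.single (y, z) 1) z)
        then trailLowerBound (m - Pi.single (y, z) 1 : V × V → ℕ) else 0) (fun z _ => ?_) (Finset.mem_univ z))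
    · rw [if_pos ⟨hle z hz, hsp⟩, hR]
    · split_ifs
      · exact (trailLowerBound_pos _).le
      · exact le_rfl
  have h2 : 2 ≤ outDeg m y := by omega
  have hR : ∀ z, 0 < m (y, z) → trailLowerBound (m - Pi.single (y, z) 1)
      = trailLowerBound m * (m (y, z) / (outDeg m y - 1 : ℕ)) := by
    intro z hz
    have hR := trailLowerBound_add_single (m - Pi.single (y, z) 1) y z
    have hd := hdeg z hz
    rw [← hdec z hz, hd] at hR
    have e1 : outDeg (m - Pi.single (y, z) 1) y = outDeg m y - 1 := by omega
    have e2 : (m - Pi.single (y, z) 1 : V × V → ℕ) (y, z) + 1 = m (y, z) := by simp; omega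
    have e3 : (((m - Pi.single (y, z) 1 : V × V → ℕ) (y, z) : ℕ) : ℝ) + 1 = m (y, z) := by exact_mod_cast e2
    rw [e1, e3] at hR
    obtain ⟨d, hd'⟩ : ∃ d, outDeg m y = d + 2 := ⟨outDeg m y - 2, by omega⟩
    rw [hd'] at hR ⊢
    have e4 : d + 2 - 1 = d + 1 := by omega
    rw [e4, Nat.add_sub_cancel, Nat.factorial_succ] at hR
    rw [e4]
    have p1 : ((d ! : ℕ) : ℝ) ≠ 0 := by positivity
    push_cast at hR ⊢
    field_simp at hR ⊢
    linarith
  have hDpos : (0 : ℝ) < (outDeg m y - 1 : ℕ) := by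
    have : 0 < outDeg m y - 1 := by omega
    exact_mod_cast this
  have hbad : ∃ z₀, ∀ z, 0 < m (y, z) → ¬ SpannedFrom (m - Pi.single (y, z) 1) z →
      z = z₀ ∧ m (y, z) = 1 := by
    by_cases hex : ∃ z₀, 0 < m (y, z₀) ∧ ¬ SpannedFrom (m - Pi.single (y, z₀) 1) z₀
    · obtain ⟨z₀, hz₀, hb₀⟩ := hex
      have hreach : ∀ z, 0 < m (y, z) → ¬ SpannedFrom (m - Pi.single (y, z) 1) z →
          ¬ Reaches (m - Pi.single (y, z) 1) z y := fun z hz hb hr =>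
        hb (SpannedFrom.of_add_single (by rw [← hdec z hz]; exact hs) (Or.inl hr))
      exact ⟨z₀, fun z hz hb => not_two_bridges (hdec z hz) (hdec z₀ hz₀) hm (hreach z hz hb)
        (hreach z₀ hz₀ hb₀)⟩
    · exact ⟨y, fun z hz hb => absurd ⟨z, hz, hb⟩ hex⟩
  obtain ⟨z₀, hz₀⟩ := hbad
  -- Subtracting one at `z₀` discounts the possible bridge. If there is none, `z₀` is arbitrary and
  -- the inequality only gets weaker.
  have hterm : ∀ z, trailLowerBound m / (outDeg m y - 1 : ℕ) * ((m (y, z) : ℝ)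
      - (Pi.single z₀ 1 : V → ℝ) z)
      ≤ if (Pi.single (y, z) 1 ≤ m ∧ SpannedFrom (m - Pi.single (y, z) 1) z)
      then trailLowerBound (m - Pi.single (y, z) 1 : V × V → ℕ) else 0 := by
    intro z
    have hRp := trailLowerBound_pos m
    have hs0 : 0 ≤ (Pi.single z₀ 1 : V → ℝ) z := by
      rw [Pi.single_apply]; split_ifs <;> norm_num
    rcases Nat.eq_zero_or_pos (m (y, z)) with h0 | h0
    · rw [h0, if_neg]
      · have : 0 ≤ trailLowerBound m / (outDeg m y - 1 : ℕ) := by positivity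
        push_cast
        nlinarith
      · rintro ⟨hz, -⟩
        have := hz (y, z)
        simp [h0] at this
    · by_cases hsp : SpannedFrom (m - Pi.single (y, z) 1) z
      · rw [if_pos ⟨hle z h0, hsp⟩, hR z h0, div_mul_eq_mul_div, mul_div_assoc]
        gcongr
        linarith
      · obtain ⟨rfl, h1⟩ := hz₀ z h0 hsp
        rw [h1]
        simp [hsp]
  refine le_trans (le_of_eq ?_) (Finset.sum_le_sum fun z _ => hterm z)
  rw [← Finset.mul_sum, Finset.sum_sub_distrib]
  have e1 : ∑ z, (m (y, z) : ℝ) = outDeg m y := by simp [outDeg]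
  rw [e1, Finset.sum_pi_single', if_pos (Finset.mem_univ _)]
  rw [Nat.cast_sub (by omega)] at hDpos ⊢
  push_cast at hDpos ⊢
  field_simp

/-- Every connected path flow is realised by many walks. -/
theorem trailLowerBound_le_sum : ∀ (L : ℕ) (y v : V) (m : V × V → ℕ), IsPathFlow m y v →
    SpannedFrom m y → ∑ e, m e = L →
    trailLowerBound m ≤ ∑ p : VertexSeq V L, (if edgeCount y p = m then (1 : ℝ) else 0)
  | 0, y, v, m, _, _, hL => by
    have hm : m = 0 := by
      funext e
      simpa using (Finset.sum_eq_zero_iff.1 hL) e (Finset.mem_univ e)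
    subst hm
    rw [VertexSeq.sum_zero]
    simp [edgeCount, trailLowerBound, outDeg]
  | L + 1, y, v, m, hm, hs, hL => by
    have hpos : 0 < outDeg m y := by
      obtain ⟨⟨a, b⟩, hab⟩ : ∃ e, 0 < m e := by
        by_contra hne
        push Not at hne
        have : ∑ e, m e = 0 := Finset.sum_eq_zero fun e _ => by have := hne e; omega
        omega
      have ha : 0 < outDeg m a := lt_of_lt_of_le hab (le_outDeg m a b)
      rcases Relation.ReflTransGen.cases_head (hs a ha) with h | ⟨c, hc, -⟩
      · rw [h]; exact ha
      · exact lt_of_lt_of_le hc (le_outDeg m y c)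
    refine (sum_sub_one_le hm hs hpos).trans ?_
    rw [VertexSeq.sum_succ]
    refine Finset.sum_le_sum fun z _ => ?_
    split_ifs with hz
    · have hdec := tsub_add_cancel_of_le hz.1
      refine (trailLowerBound_le_sum L z v (m - Pi.single (y, z) 1)
        (IsPathFlow.of_add_single (by rw [hdec]; exact hm)) hz.2 ?_).trans (le_of_eq ?_)
      · have : ∑ e, m e = ∑ e, (m - Pi.single (y, z) 1 : V × V → ℕ) e + 1 := by
          conv_lhs => rw [← hdec]
          simp only [Pi.add_apply, Finset.sum_add_distrib, Finset.sum_pi_single', Finset.mem_univ,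
            if_true]
        omega
      · refine Finset.sum_congr rfl fun p _ => ?_
        simp only [edgeCount, eq_tsub_iff_add_eq_of_le hz.1, add_comm]
    · exact Finset.sum_nonneg fun p _ => by split_ifs <;> norm_num

end Trails

/-! ### Halving multiplicities by Eulerian orientation -/

section Halving

open scoped Nat Classical

variable {V : Type} [Fintype V] [DecidableEq V]

theorem exists_eq_add_single {m : V × V → ℕ} {e : V × V} (h : 0 < m e) :
    ∃ m' : V × V → ℕ, m = m' + Pi.single e 1 := by
  refine ⟨m - Pi.single e 1, (tsub_add_cancel_of_le fun e' => ?_).symm⟩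
  by_cases he : e' = e
  · subst he; simpa [Nat.one_le_iff_ne_zero, Nat.pos_iff_ne_zero] using h
  · simp [Pi.single_eq_of_ne he]

/-- Directed form of the existence of Eulerian orientations: if all total degrees are even, then
reversing some of the edges makes in- and out-degrees agree. -/
theorem exists_balanced_split : ∀ (N : ℕ) (o : V × V → ℕ), ∑ e, o e = N →
    (∀ x, Even (outDeg o x + inDeg o x)) →
    ∃ p q : V × V → ℕ, o = p + q ∧ ∀ x, outDeg p x + inDeg q x = inDeg p x + outDeg q x := by
  intro N
  induction N using Nat.strong_induction_on with
  | _ N IH =>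
  intro o hN hev
  have hsum : ∀ (f : V × V → ℕ) (e : V × V),
      ∑ e', (f + Pi.single e 1 : V × V → ℕ) e' = ∑ e', f e' + 1 := by
    intro f e
    simp only [Pi.add_apply, Finset.sum_add_distrib, Finset.sum_pi_single', Finset.mem_univ,
      if_true]
  by_cases h0 : o = 0
  · subst h0
    exact ⟨0, 0, by simp, fun x => by simp [outDeg, inDeg]⟩
  obtain ⟨⟨a, b⟩, hab⟩ : ∃ e, 0 < o e := by
    by_contra hne
    push Not at hne
    exact h0 (funext fun e => by simpa using hne e)
  obtain ⟨t, rfl⟩ := exists_eq_add_single hab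
  rw [hsum] at hN
  by_cases hab' : a = b
  · subst hab'
    obtain ⟨p, q, hpq, hbal⟩ := IH (∑ e, t e) (by omega) t rfl (fun x => by
      have := hev x
      rw [outDeg_add_single, inDeg_add_single, Pi.add_apply, Pi.add_apply] at this
      rw [Nat.even_iff] at this ⊢
      omega)
    refine ⟨p + Pi.single (a, a) 1, q, by rw [hpq]; abel, fun x => ?_⟩
    have := hbal x
    rw [outDeg_add_single, inDeg_add_single, Pi.add_apply, Pi.add_apply]
    omega
  -- The total degree at `b` is even, so another edge meets `b` once `(a, b)` is removed.
  have hb : 0 < outDeg t b + inDeg t b := by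
    have := hev b
    rw [outDeg_add_single, inDeg_add_single, Pi.add_apply, Pi.add_apply, Pi.single_eq_same,
      Pi.single_eq_of_ne (Ne.symm hab'), Nat.even_iff] at this
    omega
  have hcase : (∃ (c : V) (t' : V × V → ℕ), t = t' + Pi.single (b, c) 1) ∨
      (∃ (c : V) (t' : V × V → ℕ), t = t' + Pi.single (c, b) 1) := by
    rcases Nat.eq_zero_or_pos (outDeg t b) with h | h
    · have h' : 0 < inDeg t b := by omega
      obtain ⟨c, hc⟩ : ∃ c, 0 < t (c, b) := by
        simpa [inDeg, Finset.sum_pos_iff] using h'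
      exact Or.inr ⟨c, exists_eq_add_single hc⟩
    · obtain ⟨c, hc⟩ := (outDeg_pos_iff t b).1 h
      exact Or.inl ⟨c, exists_eq_add_single hc⟩
  -- The path a, b, c is replaced by one edge `(a, c)` and the smaller graph is split. Afterwards,
  -- an original edge directed along the path joins the part containing `(a, c)`, and one directed
  -- against it joins the other part.
  have hsplice : ∀ (c : V) (t' : V × V → ℕ), ∑ e, t' e < ∑ e, t e →
      (∀ x, outDeg t x + inDeg t x = outDeg t' x + inDeg t' x + (Pi.single b 1 : V → ℕ) x
        + (Pi.single c 1 : V → ℕ) x) →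
      ∃ p q, t' + Pi.single (a, c) 1 = p + q ∧
        (∀ x, outDeg p x + inDeg q x = inDeg p x + outDeg q x) ∧
        ((∃ p', p = p' + Pi.single (a, c) 1 ∧ t' = p' + q) ∨
          (∃ q', q = q' + Pi.single (a, c) 1 ∧ t' = p + q')) := by
    intro c t' hlt hdeg
    obtain ⟨p, q, hpq, hbal⟩ := IH (∑ e, (t' + Pi.single (a, c) 1 : V × V → ℕ) e)
      (by rw [hsum]; omega) _ rfl (fun x => by
        have h1 := hev x
        have h2 := hdeg x
        rw [outDeg_add_single, inDeg_add_single, Pi.add_apply, Pi.add_apply] at h1 ⊢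
        rw [Nat.even_iff] at h1 ⊢
        omega)
    refine ⟨p, q, hpq, hbal, ?_⟩
    have hpos : 0 < p (a, c) + q (a, c) := by
      rw [← Pi.add_apply, ← hpq]; simp
    rcases Nat.eq_zero_or_pos (p (a, c)) with h | h
    · obtain ⟨q', rfl⟩ := exists_eq_add_single (show 0 < q (a, c) by omega)
      refine Or.inr ⟨q', rfl, ?_⟩
      rw [← add_assoc] at hpq
      exact add_right_cancel hpq
    · obtain ⟨p', rfl⟩ := exists_eq_add_single h
      refine Or.inl ⟨p', rfl, ?_⟩
      rw [add_right_comm] at hpq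
      exact add_right_cancel hpq
  rcases hcase with ⟨c, t', rfl⟩ | ⟨c, t', rfl⟩
  · obtain ⟨p, q, -, hbal, ⟨p', rfl, rfl⟩ | ⟨q', rfl, rfl⟩⟩ := hsplice c t'
      (by rw [hsum]; omega) (fun x => by
        rw [outDeg_add_single, inDeg_add_single, Pi.add_apply, Pi.add_apply]; omega)
    · refine ⟨p' + Pi.single (a, b) 1 + Pi.single (b, c) 1, q, by abel, fun x => ?_⟩
      have := hbal x
      simp only [outDeg_add_single, inDeg_add_single, Pi.add_apply] at this ⊢
      omega
    · refine ⟨p, q' + Pi.single (a, b) 1 + Pi.single (b, c) 1, by abel, fun x => ?_⟩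
      have := hbal x
      simp only [outDeg_add_single, inDeg_add_single, Pi.add_apply] at this ⊢
      omega
  · obtain ⟨p, q, -, hbal, ⟨p', rfl, rfl⟩ | ⟨q', rfl, rfl⟩⟩ := hsplice c t'
      (by rw [hsum]; omega) (fun x => by
        rw [outDeg_add_single, inDeg_add_single, Pi.add_apply, Pi.add_apply]; omega)
    · refine ⟨p' + Pi.single (a, b) 1, q + Pi.single (c, b) 1, by abel, fun x => ?_⟩
      have := hbal x
      simp only [outDeg_add_single, inDeg_add_single, Pi.add_apply] at this ⊢
      omega
    · refine ⟨p + Pi.single (c, b) 1, q' + Pi.single (a, b) 1, by abel, fun x => ?_⟩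
      have := hbal x
      simp only [outDeg_add_single, inDeg_add_single, Pi.add_apply] at this ⊢
      omega

/-- The multiplicities differing by at most one from `2 a`, except `1`; only `0` if `a = 0`. -/
def nearDouble (a : ℕ) : Finset ℕ :=
  if a = 0 then {0} else if a = 1 then {2, 3} else {2 * a - 1, 2 * a, 2 * a + 1}

/-- The flow `m` carries two units, so the odd edges form a graph with even total degrees. A
balanced split of them into `p` and `q` makes rounding up on `p` and down on `q` preserve
conservation. -/
theorem exists_half_flow {m : V × V → ℕ} {u v : V} (h1 : ∀ e, m e ≠ 1)
    (hflow : ∀ x, outDeg m x + 2 * (Pi.single v 1 : V → ℕ) x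
      = inDeg m x + 2 * (Pi.single u 1 : V → ℕ) x) (hs : SpannedFrom m u) :
    ∃ α, IsPathFlow α u v ∧ SpannedFrom α u ∧ (∀ e, m e ∈ nearDouble (α e)) ∧ ∑ e, α e ≤ ∑ e, m e := by
  have hsplit : m = (fun e => m e / 2) + (fun e => m e / 2) + fun e => m e % 2 := by
    funext e; simp only [Pi.add_apply]; omega
  obtain ⟨p, q, hpq, hbal⟩ := exists_balanced_split _ (fun e => m e % 2) rfl (fun x => by
    have e1 : outDeg m x = outDeg (fun e => m e / 2) x + outDeg (fun e => m e / 2) x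
      + outDeg (fun e => m e % 2) x := by
        conv_lhs => rw [hsplit]
        rw [outDeg_add, outDeg_add]
    have e2 : inDeg m x = inDeg (fun e => m e / 2) x + inDeg (fun e => m e / 2) x
      + inDeg (fun e => m e % 2) x := by
        conv_lhs => rw [hsplit]
        rw [inDeg_add, inDeg_add]
    have := hflow x
    rw [Nat.even_iff]
    omega)
  have hpq' : ∀ e, m e % 2 = p e + q e := fun e => congrFun hpq e
  set α : V × V → ℕ := fun e => (m e + p e - q e) / 2 with hα
  have hαe : ∀ e, α e + α e + q e = m e + p e := fun e => by
    have := hpq' e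
    have := h1 e
    simp only [hα]
    omega
  have hαf : α + α + q = m + p := funext hαe
  -- Since multiplicity 1 is excluded, rounding down never deletes an edge, and connectivity is
  -- inherited.
  have hsupp : ∀ e, 0 < m e → 0 < α e := fun e he => by
    have := hpq' e
    have := h1 e
    have := hαe e
    omega
  refine ⟨α, fun x => ?_, fun x hx => ?_, fun e => ?_, ?_⟩
  · have e1 : outDeg (α + α + q) x = outDeg (m + p) x := by rw [hαf]
    have e2 : inDeg (α + α + q) x = inDeg (m + p) x := by rw [hαf]
    simp only [outDeg_add, inDeg_add] at e1 e2
    have := hflow x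
    have := hbal x
    omega
  · have hx' : 0 < outDeg m x := by
      obtain ⟨z, hz⟩ := (outDeg_pos_iff α x).1 hx
      refine (outDeg_pos_iff m x).2 ⟨z, ?_⟩
      have := hpq' (x, z)
      have := hαe (x, z)
      omega
    exact Relation.ReflTransGen.mono (fun a b hab => hsupp (a, b) hab) _ _ (hs x hx')
  · have := hpq' e
    have := h1 e
    have := hαe e
    unfold nearDouble
    split_ifs with ha ha
    · rw [Finset.mem_singleton]; omega
    · rw [Finset.mem_insert, Finset.mem_singleton]; omega
    · rw [Finset.mem_insert, Finset.mem_insert, Finset.mem_singleton]; omega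
  · refine Finset.sum_le_sum fun e _ => ?_
    have := hpq' e
    have := h1 e
    have := hαe e
    omega

end Halving

/-! ### From pairs of walks to single walks -/

section WalkPairs

open scoped Nat Classical

variable {V : Type} [Fintype V] [DecidableEq V]

theorem factorial_add_le_mul_pow (a q : ℕ) : (a + q)! ≤ a ! * (a + q) ^ q := by
  induction q with
  | zero => simp
  | succ q ih =>
    rw [← add_assoc, Nat.factorial_succ, pow_succ]
    calc (a + q + 1) * (a + q)! ≤ (a + q + 1) * (a ! * (a + q) ^ q) := Nat.mul_le_mul_left _ ih
      _ ≤ (a + q + 1) * (a ! * (a + q + 1) ^ q) 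
          := Nat.mul_le_mul_left _ (Nat.mul_le_mul_left _ (Nat.pow_le_pow_left (Nat.le_succ _) q))
      _ = _ := by ring

/-- The cost of an odd multiplicity `2 a + 1` at an edge starting in a vertex of degree `d`. -/
noncomputable def oddCost (d a j : ℕ) : ℝ := if j = 2 * a + 1 then 3 * d else 1

theorem oddCost_nonneg (d a j : ℕ) : 0 ≤ oddCost d a j := by
  unfold oddCost; split_ifs <;> positivity

/-- If q edges at `x` were rounded down and d is the out-degree in `α`, then `outDeg m x` ≤ 2d + q.
Each of these edges has α ≥ 1, so q ≤ d, and each excess factor of the factorial is at most 3d. -/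
theorem factorial_outDeg_le {α m : V × V → ℕ} (h : ∀ e, m e ∈ nearDouble (α e)) (x : V) :
    ((outDeg m x)! : ℝ) ≤ (2 * outDeg α x)! * ∏ z, oddCost (outDeg α x) (α (x, z)) (m (x, z)) := by
  set q := (Finset.univ.filter fun z => m (x, z) = 2 * α (x, z) + 1).card with hq
  have hprod : ∏ z, oddCost (outDeg α x) (α (x, z)) (m (x, z)) = (3 * outDeg α x : ℝ) ^ q := by
    unfold oddCost
    rw [Finset.prod_ite, Finset.prod_const, Finset.prod_const_one, mul_one]
  have hme : ∀ z, m (x, z) ≤ 2 * α (x, z) + (if m (x, z) = 2 * α (x, z) + 1 then 1 else 0) ∧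
      (if m (x, z) = 2 * α (x, z) + 1 then 1 else 0) ≤ α (x, z) := by
    intro z
    have := h (x, z)
    unfold nearDouble at this
    split_ifs at this with h0 h1 <;>
      simp only [Finset.mem_singleton, Finset.mem_insert] at this <;> split_ifs <;> omega
  have hq' : q = ∑ z, (if m (x, z) = 2 * α (x, z) + 1 then 1 else 0) := by
    rw [hq, Finset.card_filter]
  have hD : outDeg m x ≤ 2 * outDeg α x + q := by
    rw [hq', outDeg, outDeg, Finset.mul_sum, ← Finset.sum_add_distrib]
    exact Finset.sum_le_sum fun z _ => (hme z).1
  have hqle : q ≤ outDeg α x := by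
    rw [hq']; exact Finset.sum_le_sum fun z _ => (hme z).2
  rw [hprod]
  have : (outDeg m x)! ≤ (2 * outDeg α x)! * (3 * outDeg α x) ^ q :=
    ((Nat.factorial_le hD).trans (factorial_add_le_mul_pow _ _)).trans (by gcongr; omega)
  exact_mod_cast this

/-- Once the degree factorials no longer depend on `m`, the sum over `m` factorises over the edges.
-/
theorem sum_nearDouble_le (w : V × V → ℕ → ℝ) (hw : ∀ e j, 0 ≤ w e j) (α : V × V → ℕ) :
    ∑ m ∈ Fintype.piFinset (fun e => nearDouble (α e)),
        (∏ x, ((outDeg m x)! : ℝ)) * ∏ e, w e (m e) ≤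
      (∏ x, ((2 * outDeg α x)! : ℝ)) *
        ∏ e, ∑ j ∈ nearDouble (α e), oddCost (outDeg α e.1) (α e) j * w e j := by
  rw [Finset.prod_univ_sum, Finset.mul_sum]
  refine Finset.sum_le_sum fun m hm => ?_
  rw [Fintype.mem_piFinset] at hm
  rw [Finset.prod_mul_distrib, ← mul_assoc]
  refine mul_le_mul_of_nonneg_right ?_ (Finset.prod_nonneg fun e _ => hw e _)
  rw [Fintype.prod_prod_type, ← Finset.prod_mul_distrib]
  exact Finset.prod_le_prod (fun x _ => by positivity) fun x _ => factorial_outDeg_le hm x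

theorem exists_half_flow_of_pair {k : ℕ} {u : V} {p q : VertexSeq V k}
    (hpq : lastVertex u p = lastVertex u q) (h1 : ∀ e, (edgeCount u p + edgeCount u q) e ≠ 1) :
    ∃ α, (∃ v, IsPathFlow α u v) ∧ SpannedFrom α u ∧
      (∀ e, (edgeCount u p + edgeCount u q) e ∈ nearDouble (α e)) ∧ ∑ e, α e ≤ 2 * k := by
  obtain ⟨α, h1, h2, h3, h4⟩ := exists_half_flow (u := u) (v := lastVertex u p) h1 (fun x => by
    have hp := outDeg_edgeCount_add u p x
    have hq := outDeg_edgeCount_add u q x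
    rw [← hpq] at hq
    rw [outDeg_add, inDeg_add]
    omega) (fun x hx => by
    rw [outDeg_add] at hx
    rcases Nat.eq_zero_or_pos (outDeg (edgeCount u p) x) with h | h
    · exact reachable_of_edgeCount_pos u q _ (fun e => by simp) x (by omega)
    · exact reachable_of_edgeCount_pos u p _ (fun e => by simp) x h)
  refine ⟨α, ⟨_, h1⟩, h2, h3, h4.trans (le_of_eq ?_)⟩
  simp only [Pi.add_apply, Finset.sum_add_distrib, sum_edgeCount]
  ring

/-- The sum over pairs of walks with common end points is bounded by a sum over single walks
whose edges are weighted by the square of the original weight. -/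
theorem sum_pairs_le_sum_walks (g : V × V → ℕ → ℝ) (hg : ∀ e j, 0 ≤ g e j)
    (hg1 : ∀ e, g e 1 = 0) (k : ℕ) (u : V) (W : (V × V → ℕ) → ℝ)
    (hW : ∀ m, 0 ≤ W m)
    (hgW : ∀ α : V × V → ℕ, ∑ e, α e ≤ 2 * k → (∏ x, ((2 * outDeg α x)! : ℝ)) *
        (∏ e, ∑ j ∈ nearDouble (α e), oddCost (outDeg α e.1) (α e) j * (g e j / j !)) ≤
      trailLowerBound α * W α) :
    ∑ p : VertexSeq V k, ∑ q : VertexSeq V k, (if lastVertex u p = lastVertex u q then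
        ∏ e, g e (edgeCount u p e + edgeCount u q e) else 0) ≤
      ∑ L ∈ Finset.range (2 * k + 1), ∑ c : VertexSeq V L, W (edgeCount u c) := by
  -- Pairs using some edge exactly once contribute nothing, by `hg1`.
  set T : Finset (VertexSeq V k × VertexSeq V k) := Finset.univ.filter fun pq =>
    lastVertex u pq.1 = lastVertex u pq.2 ∧
      ∀ e, (edgeCount u pq.1 + edgeCount u pq.2) e ≠ 1 with hT
  set M : Finset (V × V → ℕ) := T.image fun pq => edgeCount u pq.1 + edgeCount u pq.2 with hM
  set G : (V × V → ℕ) → ℝ := fun m => ∏ e, g e (m e) with hG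
  have hG0 : ∀ m, 0 ≤ G m := fun m => Finset.prod_nonneg fun e _ => hg e _
  have hpairs : ∑ p : VertexSeq V k, ∑ q : VertexSeq V k, (if lastVertex u p = lastVertex u q then
        ∏ e, g e (edgeCount u p e + edgeCount u q e) else 0) ≤
      ∑ m ∈ M, departureOrders m * G m := by
    calc _ = ∑ pq : VertexSeq V k × VertexSeq V k,
          (if lastVertex u pq.1 = lastVertex u pq.2 then
            G (edgeCount u pq.1 + edgeCount u pq.2) else 0) := by
          rw [Fintype.sum_prod_type]; rfl
      _ = ∑ pq ∈ T, G (edgeCount u pq.1 + edgeCount u pq.2) := by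
          rw [hT, Finset.sum_filter]
          refine Finset.sum_congr rfl fun pq _ => ?_
          by_cases h : lastVertex u pq.1 = lastVertex u pq.2
          · by_cases h' : ∀ e, (edgeCount u pq.1 + edgeCount u pq.2) e ≠ 1
            · rw [if_pos h, if_pos ⟨h, h'⟩]
            · rw [if_pos h, if_neg (fun hh => h' hh.2)]
              push Not at h'
              obtain ⟨e, he⟩ := h'
              exact Finset.prod_eq_zero (Finset.mem_univ e) (by rw [he, hg1])
          · rw [if_neg h, if_neg (fun hh => h hh.1)]
      _ = ∑ m ∈ M, ∑ pq ∈ T.filter (fun pq => edgeCount u pq.1 + edgeCount u pq.2 = m),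
            G (edgeCount u pq.1 + edgeCount u pq.2) :=
          (Finset.sum_fiberwise_of_maps_to (fun pq hpq => Finset.mem_image_of_mem _ hpq) _).symm
      _ ≤ ∑ m ∈ M, departureOrders m * G m := by
          refine Finset.sum_le_sum fun m _ => ?_
          rw [Finset.sum_congr rfl (g := fun _ => G m)
            (fun pq hpq => by rw [(Finset.mem_filter.1 hpq).2]), Finset.sum_const, nsmul_eq_mul]
          refine mul_le_mul_of_nonneg_right ?_ (hG0 m)
          refine le_trans ?_ (sum_pair_edgeCount_eq_le k k u u m)
          rw [← Fintype.sum_prod_type (f := fun pq : VertexSeq V k × VertexSeq V k =>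
            if edgeCount u pq.1 + edgeCount u pq.2 = m then (1 : ℝ) else 0), Finset.sum_boole]
          exact_mod_cast Finset.card_le_card (Finset.filter_subset_filter _ (Finset.subset_univ _))
  have hex : ∀ m ∈ M, ∃ α, (∃ v, IsPathFlow α u v) ∧ SpannedFrom α u ∧
      (∀ e, m e ∈ nearDouble (α e)) ∧ ∑ e, α e ≤ 2 * k := by
    intro m hm
    obtain ⟨pq, hpq, rfl⟩ := Finset.mem_image.1 hm
    have := (Finset.mem_filter.1 hpq).2
    exact exists_half_flow_of_pair this.1 this.2
  choose! f hf using hex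
  -- The multiplicities with the same half flow lie in a product of `nearDouble` sets, where `hgW`
  -- applies.
  have hflows : ∑ m ∈ M, departureOrders m * G m ≤ ∑ α ∈ M.image f, trailLowerBound α * W α := by
    rw [← Finset.sum_fiberwise_of_maps_to (g := f) (t := M.image f)
      (fun m hm => Finset.mem_image_of_mem _ hm)]
    refine Finset.sum_le_sum fun α hα => ?_
    obtain ⟨m₀, hm₀, rfl⟩ := Finset.mem_image.1 hα
    refine le_trans ?_ ((sum_nearDouble_le (fun e j => g e j / j !)
      (fun e j => div_nonneg (hg e j) (by positivity)) (f m₀)).trans (hgW _ (hf _ hm₀).2.2.2))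
    refine le_trans (le_of_eq ?_) (Finset.sum_le_sum_of_subset_of_nonneg
      (s := M.filter fun m => f m = f m₀) ?_ ?_)
    · refine Finset.sum_congr rfl fun m _ => ?_
      simp only [departureOrders, hG, Finset.prod_div_distrib]
      ring
    · intro m hm
      obtain ⟨hm, hfm⟩ := Finset.mem_filter.1 hm
      rw [Fintype.mem_piFinset, ← hfm]
      exact (hf m hm).2.2.1
    · exact fun m _ _ => mul_nonneg (by positivity)
        (Finset.prod_nonneg fun e _ => div_nonneg (hg e _) (by positivity))
  -- Each `trailLowerBound α` is replaced by the number of walks realising `α`, sorted by length.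
  have hwalks : ∑ α ∈ M.image f, trailLowerBound α * W α ≤ ∑ L ∈ Finset.range (2 * k + 1),
      ∑ α ∈ (M.image f).filter (fun α => ∑ e, α e = L), ∑ c : VertexSeq V L,
        (if edgeCount u c = α then W α else 0) := by
    rw [← Finset.sum_fiberwise_of_maps_to (g := fun α : V × V → ℕ => ∑ e, α e)
      (t := Finset.range (2 * k + 1)) (fun α hα => by
        obtain ⟨m, hm, rfl⟩ := Finset.mem_image.1 hα
        rw [Finset.mem_range, Nat.lt_succ_iff]
        exact (hf m hm).2.2.2)]
    refine Finset.sum_le_sum fun L _ => Finset.sum_le_sum fun α hα => ?_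
    obtain ⟨hα, hL⟩ := Finset.mem_filter.1 hα
    obtain ⟨m, hm, rfl⟩ := Finset.mem_image.1 hα
    obtain ⟨v, hv⟩ := (hf m hm).1
    refine (mul_le_mul_of_nonneg_right
      (trailLowerBound_le_sum L u v _ hv (hf m hm).2.1 hL) (hW _)).trans (le_of_eq ?_)
    rw [Finset.sum_mul]
    exact Finset.sum_congr rfl fun c _ => by split_ifs <;> simp
  refine (hpairs.trans hflows).trans (hwalks.trans (Finset.sum_le_sum fun L _ => ?_))
  rw [Finset.sum_comm]
  refine Finset.sum_le_sum fun c _ => ?_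
  rw [Finset.sum_ite_eq]
  split_ifs
  · exact le_rfl
  · exact hW _

end WalkPairs

/-! ### Summing weighted walks step by step -/

section WalkWeights

open scoped Nat Classical

variable {V : Type} [Fintype V] [DecidableEq V]

/-- A multiplicative weight of an edge multiplicity function: `v` weighs the degrees of the
vertices, `η` the multiplicities, and every use of an edge `e` costs `S e`. -/
noncomputable def walkWeight (S : V × V → ℝ) (v η : ℕ → ℝ) (α : V × V → ℕ) : ℝ :=
  (∏ x, v (outDeg α x)) * (∏ e, S e ^ α e) * ∏ e, η (α e)

theorem walkWeight_nonneg {S : V × V → ℝ} {v η : ℕ → ℝ} (hS : ∀ e, 0 ≤ S e) (hv : ∀ a, 0 < v a)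
    (hη : ∀ a, 0 < η a) (α : V × V → ℕ) : 0 ≤ walkWeight S v η α :=
  mul_nonneg (mul_nonneg (Finset.prod_nonneg fun _ _ => (hv _).le)
    (Finset.prod_nonneg fun e _ => pow_nonneg (hS e) _)) (Finset.prod_nonneg fun _ _ => (hη _).le)

theorem walkWeight_add_single_le {S : V × V → ℝ} {v η : ℕ → ℝ} (hS : ∀ e, 0 ≤ S e)
    (hv : ∀ a, 0 < v a) (hη : ∀ a, 0 < η a) (β : V × V → ℕ) (y z : V) {r q : ℝ}
    (hr : v (outDeg β y + 1) ≤ r * v (outDeg β y))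
    (hq : η (β (y, z) + 1) ≤ q * η (β (y, z))) :
    walkWeight S v η (β + Pi.single (y, z) 1) ≤ walkWeight S v η β * r * (S (y, z) * q) := by
  have e1 := prod_add_single v (outDeg β) y
  have e2 := prod_add_single η β (y, z)
  have e3 : ∏ e, S e ^ (β + Pi.single (y, z) 1 : V × V → ℕ) e = (∏ e, S e ^ β e) * S (y, z) := by
    simp only [Pi.add_apply, pow_add, Finset.prod_mul_distrib]
    congr 1
    rw [Finset.prod_eq_single (y, z)]
    · simp
    · intro e _ he; simp [Pi.single_eq_of_ne he]
    · simp
  unfold walkWeight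
  rw [outDeg_add_single, e3]
  have p1 : 0 ≤ ∏ x, v (outDeg β x) := Finset.prod_nonneg fun x _ => (hv _).le
  have p2 : 0 ≤ ∏ e, η (β e) := Finset.prod_nonneg fun e _ => (hη _).le
  have p3 : 0 ≤ ∏ e, S e ^ β e := Finset.prod_nonneg fun e _ => pow_nonneg (hS e) _
  have i1 : ∏ x, v ((outDeg β + Pi.single y 1 : V → ℕ) x) ≤ (∏ x, v (outDeg β x)) * r := by
    refine le_of_mul_le_mul_right ?_ (hv (outDeg β y))
    rw [e1, mul_assoc]
    exact mul_le_mul_of_nonneg_left hr p1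
  have i2 : ∏ e, η ((β + Pi.single (y, z) 1 : V × V → ℕ) e) ≤ (∏ e, η (β e)) * q := by
    refine le_of_mul_le_mul_right ?_ (hη (β (y, z)))
    rw [e2, mul_assoc]
    exact mul_le_mul_of_nonneg_left hq p2
  have p4 : 0 ≤ ∏ x, v ((outDeg β + Pi.single y 1 : V → ℕ) x) :=
    Finset.prod_nonneg fun x _ => (hv _).le
  have p5 : 0 ≤ ∏ e, η ((β + Pi.single (y, z) 1 : V × V → ℕ) e) :=
    Finset.prod_nonneg fun e _ => (hη _).le
  calc _ ≤ (∏ x, v (outDeg β x)) * r * ((∏ e, S e ^ β e) * S (y, z)) * ((∏ e, η (β e)) * q) :=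
        mul_le_mul (mul_le_mul_of_nonneg_right i1 (mul_nonneg p3 (hS _))) i2 p5
          (mul_nonneg (p4.trans i1) (mul_nonneg p3 (hS _)))
    _ = _ := by ring

/-- If degrees and multiplicities grow slowly, the weights of all walks of a given length that
extend a given walk can be summed step by step. -/
theorem sum_walkWeight_add_le {S : V × V → ℝ} {v η : ℕ → ℝ} {θ σ Q : ℝ} {N : ℕ}
    (hS : ∀ e, 0 ≤ S e) (hSσ : ∀ e, S e ≤ σ) (hrow : ∀ x, ∑ z, S (x, z) ≤ 1)
    (hv : ∀ a, 0 < v a) (hη : ∀ a, 0 < η a) (hθ : 0 ≤ θ) (hQ : 1 ≤ Q) (hσ : 0 ≤ σ)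
    (hN : 108 * Q * σ * N ≤ 1)
    (hv0 : v 1 ≤ (1 + θ) * v 0) (hv1 : ∀ a, 1 ≤ a → a < N → v (a + 1) ≤ 54 * a * v a)
    (hη0 : η 1 ≤ η 0) (hη1 : ∀ a, 1 ≤ a → a < N → η (a + 1) ≤ Q * η a) :
    ∀ (L : ℕ) (β : V × V → ℕ) (y : V),
      -- Invariant of a walk that has arrived at `y`: every other vertex it entered has also been
      -- left.
      (∀ x z, 0 < β (x, z) → 0 < outDeg β z ∨ z = y) → ∑ e, β e + L ≤ N →
      ∑ c : VertexSeq V L, walkWeight S v η (β + edgeCount y c) ≤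
        walkWeight S v η β * (if outDeg β y = 0 then 1 + θ else 108 * outDeg β y) *
          (1 + θ + 108 * σ * N) ^ L
  | 0, β, y, _, _ => by
    rw [VertexSeq.sum_zero, pow_zero, mul_one]
    simp only [edgeCount, add_zero]
    refine le_mul_of_one_le_right (walkWeight_nonneg hS hv hη β) ?_
    split_ifs with h
    · linarith
    · have : (1 : ℝ) ≤ outDeg β y := by exact_mod_cast Nat.one_le_iff_ne_zero.2 h
      linarith
  | L + 1, β, y, hinv, hL => by
    set Λ := 1 + θ + 108 * σ * N with hΛ
    have hσN : 0 ≤ σ * N := by positivity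
    have hΛ0 : 0 ≤ Λ := by rw [hΛ]; nlinarith
    have hW := walkWeight_nonneg hS hv hη β
    have hdeg : outDeg β y ≤ ∑ e, β e := by
      rw [← sum_outDeg]
      exact Finset.single_le_sum (f := fun x => outDeg β x) (fun _ _ => Nat.zero_le _)
        (Finset.mem_univ y)
    set r : ℝ := if outDeg β y = 0 then 1 + θ else 54 * outDeg β y with hr
    have hr0 : 0 ≤ r := by rw [hr]; split_ifs <;> positivity
    set q : V → ℝ := fun z => if β (y, z) = 0 then 1 else Q with hq
    have hq0 : ∀ z, 0 ≤ q z := fun z => by simp only [hq]; split_ifs <;> linarith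
    set β' : V → V × V → ℕ := fun z => β + Pi.single (y, z) 1 with hβ'
    -- The factor `ρ z` pays in advance for the next departure from `z`.
    set ρ : V → ℝ := fun z => if outDeg (β' z) z = 0 then 1 + θ else 108 * outDeg (β' z) z with hρ
    have hρ0 : ∀ z, 0 ≤ ρ z := fun z => by simp only [hρ]; split_ifs <;> positivity
    have hstep : ∀ z, walkWeight S v η (β' z) ≤ walkWeight S v η β * r * (S (y, z) * q z) := by
      intro z
      refine walkWeight_add_single_le hS hv hη β y z ?_ ?_
      · rw [hr]
        split_ifs with h
        · rw [h]; exact hv0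
        · exact hv1 _ (Nat.one_le_iff_ne_zero.2 h) (by omega)
      · simp only [hq]
        split_ifs with h
        · rw [h, one_mul]; exact hη0
        · have := le_outDeg β y z
          exact hη1 _ (Nat.one_le_iff_ne_zero.2 h) (by omega)
    have hdegz : ∀ z, outDeg (β' z) z = outDeg β z + (Pi.single y 1 : V → ℕ) z := by
      intro z
      simp only [hβ', outDeg_add_single, Pi.add_apply]
    have hsumdeg : ∑ z, (outDeg (β' z) z : ℝ) ≤ N := by
      have : ∑ z, outDeg (β' z) z ≤ N := by
        simp only [hdegz, Finset.sum_add_distrib, Finset.sum_pi_single', Finset.mem_univ, if_true,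
          sum_outDeg]
        omega
      exact_mod_cast this
    have hind : ∀ z, ∑ c : VertexSeq V L, walkWeight S v η (β' z + edgeCount z c) ≤
        walkWeight S v η (β' z) * ρ z * Λ ^ L := by
      intro z
      refine sum_walkWeight_add_le hS hSσ hrow hv hη hθ hQ hσ hN hv0 hv1 hη0 hη1 L (β' z) z ?_ ?_
      · intro x w hxw
        by_cases hwz : w = z
        · exact Or.inr hwz
        left
        simp only [hβ', outDeg_add_single, Pi.add_apply] at hxw ⊢
        rw [Pi.single_eq_of_ne (by rintro ⟨⟩; exact hwz rfl)] at hxw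
        rcases hinv x w (by omega) with h | rfl
        · omega
        · rw [Pi.single_eq_same]; omega
      · simp only [hβ', Pi.add_apply, Finset.sum_add_distrib, Finset.sum_pi_single',
          Finset.mem_univ, if_true]
        omega
    -- By the invariant, an edge into a vertex never left before is itself new, so edge penalties
    -- occur only at returns.
    have hfresh : ∀ z, outDeg (β' z) z = 0 → q z = 1 := by
      intro z hz
      rw [hdegz] at hz
      have hzy : z ≠ y := by
        rintro rfl
        rw [Pi.single_eq_same] at hz; omega
      simp only [hq]
      rw [if_pos]
      by_contra hne
      rcases hinv y z (Nat.pos_of_ne_zero hne) with h | h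
      · omega
      · exact hzy h
    have hbound : ∀ B : ℝ, (∀ z, q z ≤ B) → ∑ z, S (y, z) * q z * ρ z ≤
        1 + θ + 108 * B * σ * N := by
      intro B hB
      have hB0 : 0 ≤ B := (hq0 y).trans (hB y)
      calc ∑ z, S (y, z) * q z * ρ z
          ≤ ∑ z, ((1 + θ) * S (y, z) + 108 * B * σ * outDeg (β' z) z) := by
            refine Finset.sum_le_sum fun z _ => ?_
            by_cases h : outDeg (β' z) z = 0
            · simp only [hρ, if_pos h, hfresh z h, h]
              simp only [Nat.cast_zero, mul_zero, add_zero, mul_one]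
              rw [mul_comm]
            · simp only [hρ, if_neg h]
              have h1 : S (y, z) * q z ≤ σ * B := mul_le_mul (hSσ _) (hB z) (hq0 z) hσ
              have h2 : (0 : ℝ) ≤ 108 * outDeg (β' z) z := by positivity
              have h3 := mul_le_mul_of_nonneg_right h1 h2
              have h4 : 0 ≤ (1 + θ) * S (y, z) := mul_nonneg (by linarith) (hS _)
              nlinarith
        _ = (1 + θ) * ∑ z, S (y, z) + 108 * B * σ * ∑ z, (outDeg (β' z) z : ℝ) := by
            rw [Finset.sum_add_distrib, Finset.mul_sum, Finset.mul_sum]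
        _ ≤ (1 + θ) * 1 + 108 * B * σ * N := by
            gcongr
            exact hrow y
        _ = _ := by ring
    -- From a vertex never left before all edges are new and `hbound` holds with B = 1, giving
    -- exactly Λ. Otherwise B = Q costs at most another factor 2 by `hN`, which is why 108 = 2 · 54.
    have hmain : r * ∑ z, S (y, z) * q z * ρ z ≤
        (if outDeg β y = 0 then 1 + θ else 108 * outDeg β y) * Λ := by
      by_cases h : outDeg β y = 0
      · rw [hr, if_pos h, if_pos h]
        refine mul_le_mul_of_nonneg_left ((hbound 1 fun z => ?_).trans (le_of_eq ?_)) (by linarith)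
        · have : β (y, z) = 0 := by have := le_outDeg β y z; omega
          simp only [hq, this, if_true, le_refl]
        · rw [hΛ, mul_one]
      · rw [hr, if_neg h, if_neg h]
        have h1 := hbound Q fun z => by simp only [hq]; split_ifs <;> linarith
        have h2 : ∑ z, S (y, z) * q z * ρ z ≤ 2 * Λ := by
          rw [hΛ]; nlinarith
        calc 54 * (outDeg β y : ℝ) * ∑ z, S (y, z) * q z * ρ z
            ≤ 54 * (outDeg β y : ℝ) * (2 * Λ) := by gcongr
          _ = _ := by ring
    rw [VertexSeq.sum_succ]
    calc ∑ z, ∑ c : VertexSeq V L, walkWeight S v η (β + edgeCount y (k := L + 1) (z, c))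
        = ∑ z, ∑ c : VertexSeq V L, walkWeight S v η (β' z + edgeCount z c) := by
          simp only [edgeCount, hβ', add_assoc]
      _ ≤ ∑ z, walkWeight S v η β * r * (S (y, z) * q z) * ρ z * Λ ^ L := by
          refine Finset.sum_le_sum fun z _ => (hind z).trans ?_
          exact mul_le_mul_of_nonneg_right (mul_le_mul_of_nonneg_right (hstep z) (hρ0 z))
            (pow_nonneg hΛ0 _)
      _ = walkWeight S v η β * (r * ∑ z, S (y, z) * q z * ρ z) * Λ ^ L := by
          rw [Finset.mul_sum, Finset.mul_sum, Finset.sum_mul]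
          exact Finset.sum_congr rfl fun z _ => by ring
      _ ≤ walkWeight S v η β *
          ((if outDeg β y = 0 then 1 + θ else 108 * outDeg β y) * Λ) * Λ ^ L :=
          mul_le_mul_of_nonneg_right (mul_le_mul_of_nonneg_left hmain hW) (pow_nonneg hΛ0 _)
      _ = _ := by rw [pow_succ]; ring

end WalkWeights

/-! ### Concrete weights and the bound for pairs of walks -/

section ConcreteWeights

open scoped Nat Classical

variable {V : Type} [Fintype V] [DecidableEq V]

/-- The weight of a vertex of degree `a`. -/
noncomputable def vertexWeight (θ : ℝ) (a : ℕ) : ℝ :=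
  (2 * a)! / (2 ^ a * (a - 1)!) * (1 + θ * a) ^ a

/-- The weight of an edge of multiplicity `a`. -/
noncomputable def edgeWeight (C R : ℝ) (a : ℕ) : ℝ :=
  if a ≤ 1 then 1 else a ! * (2 * C ^ 2) ^ a * R

theorem vertexWeight_pos {θ : ℝ} (hθ : 0 ≤ θ) (a : ℕ) : 0 < vertexWeight θ a := by
  unfold vertexWeight; positivity

theorem edgeWeight_pos {C R : ℝ} (hC : 0 < C) (hR : 0 < R) (a : ℕ) : 0 < edgeWeight C R a := by
  unfold edgeWeight; split_ifs <;> positivity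

/-- This factor must be close to 1: a walk may visit order k vertices once each, so a larger
constant would grow exponentially in k. -/
theorem vertexWeight_one (θ : ℝ) : vertexWeight θ 1 = (1 + θ) * vertexWeight θ 0 := by
  simp [vertexWeight]

/-- The factorial part grows by at most 6a and the power by at most 6, leaving room in 54a. -/
theorem vertexWeight_succ_le {θ : ℝ} (hθ : 0 ≤ θ) {a : ℕ} (ha : 1 ≤ a)
    (haθ : θ * (a + 1) ≤ 1) : vertexWeight θ (a + 1) ≤ 54 * a * vertexWeight θ a := by
  obtain ⟨d, rfl⟩ : ∃ d, a = d + 1 := ⟨a - 1, by omega⟩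
  have h1 : (1 + θ * ((d + 1 : ℕ) + 1 : ℝ)) ^ (d + 1 + 1) ≤ 6 * (1 + θ * (d + 1 : ℕ)) ^ (d + 1) := by
    push_cast at haθ ⊢
    have e1 : 1 + θ * ((d : ℝ) + 1 + 1) ≤ (1 + θ) * (1 + θ * (d + 1)) := by
      nlinarith [mul_nonneg (mul_nonneg hθ hθ) (by positivity : (0 : ℝ) ≤ (d : ℝ) + 1)]
    have e2 : (1 + θ) ^ (d + 1) ≤ 3 := by
      calc (1 + θ) ^ (d + 1) ≤ Real.exp θ ^ (d + 1) := by
            gcongr; linarith [Real.add_one_le_exp θ]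
        _ = Real.exp (θ * (d + 1)) := by rw [← Real.exp_nat_mul]; push_cast; ring_nf
        _ ≤ Real.exp 1 := Real.exp_le_exp.2 (by nlinarith)
        _ ≤ 3 := by linarith [Real.exp_one_lt_d9]
    calc (1 + θ * ((d : ℝ) + 1 + 1)) ^ (d + 1 + 1)
        = (1 + θ * ((d : ℝ) + 1 + 1)) ^ (d + 1) * (1 + θ * ((d : ℝ) + 1 + 1)) := pow_succ _ _
      _ ≤ ((1 + θ) * (1 + θ * (d + 1))) ^ (d + 1) * 2 := by gcongr; linarith
      _ = (1 + θ) ^ (d + 1) * 2 * (1 + θ * (d + 1)) ^ (d + 1) := by rw [mul_pow]; ring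
      _ ≤ 3 * 2 * (1 + θ * (d + 1)) ^ (d + 1) := by gcongr
      _ = _ := by ring
  unfold vertexWeight
  have f1 : ((2 * (d + 1 + 1))! : ℝ) = (2 * d + 4) * (2 * d + 3) * (2 * (d + 1))! := by
    rw [show 2 * (d + 1 + 1) = 2 * (d + 1) + 1 + 1 by ring, Nat.factorial_succ, Nat.factorial_succ]
    push_cast; ring
  have f2 : ((d + 1 + 1 - 1)! : ℝ) = (d + 1) * d ! := by
    rw [Nat.add_sub_cancel, Nat.factorial_succ]
    push_cast; ring
  rw [f1, f2, Nat.add_sub_cancel]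
  push_cast at h1 ⊢
  set P := (1 + θ * ((d : ℝ) + 1)) ^ (d + 1)
  have hP : 0 ≤ P := by positivity
  set F := ((2 * (d + 1))! : ℝ) / (2 ^ (d + 1) * d !) with hF
  have hF0 : 0 ≤ F := by positivity
  have e3 : (2 * (d : ℝ) + 4) * (2 * d + 3) * (2 * (d + 1))! / (2 ^ (d + 1 + 1) * ((d + 1) *
      d !)) = F * ((d + 2) * (2 * d + 3) / (d + 1)) := by
    rw [hF, pow_succ]; field_simp; ring
  have e4 : ((d : ℝ) + 2) * (2 * d + 3) / (d + 1) ≤ 6 * (d + 1) := by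
    rw [div_le_iff₀ (by positivity)]; nlinarith [(Nat.cast_nonneg d : (0 : ℝ) ≤ d)]
  rw [e3]
  calc _ ≤ F * (6 * (d + 1)) * (6 * P) := by gcongr
    _ ≤ _ := by
      have : 0 ≤ F * (d + 1) * P := by positivity
      nlinarith

theorem edgeWeight_succ_le {C R : ℝ} (hC : 1 ≤ C) (hR : 0 < R) {a : ℕ}
    (ha : 1 ≤ a) (haR : (a + 1 : ℝ) ≤ 4 * C ^ 2 * R) :
    edgeWeight C R (a + 1) ≤ 8 * C ^ 4 * R * edgeWeight C R a := by
  unfold edgeWeight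
  rw [if_neg (by omega)]
  split_ifs with h
  · obtain rfl : a = 1 := by omega
    refine le_of_eq ?_
    norm_num [Nat.factorial]
    left; ring
  · rw [Nat.factorial_succ, pow_succ]
    push_cast
    have h0 : (0 : ℝ) ≤ a ! * (2 * C ^ 2) ^ a * R := by positivity
    calc ((a : ℝ) + 1) * a ! * ((2 * C ^ 2) ^ a * (2 * C ^ 2)) * R
        = (a + 1) * (2 * C ^ 2) * (a ! * (2 * C ^ 2) ^ a * R) := by ring
      _ ≤ (4 * C ^ 2 * R) * (2 * C ^ 2) * (a ! * (2 * C ^ 2) ^ a * R) := by gcongr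
      _ = _ := by ring

/-- For a = 1 the variance term b²/2 is kept exactly, and triple use adds the relative error 6C³sd.
For a ≥ 2 a crude factor of order 1/s suffices: repeating an edge also carries a variance of order
s², and k·s is small. -/
theorem sum_oddCost_le {C c s b : ℝ} {g : ℕ → ℝ} (hC : 1 ≤ C) (hc : 0 < c) (hs : 0 < s)
    (hs1 : s ≤ 1) (hcb : c * s ≤ b) (hbs : b ≤ s)
    (hg0 : g 0 ≤ 1) (hg2 : g 2 ≤ b ^ 2) (hg : ∀ j, 3 ≤ j → g j ≤ j ! * (C * b) ^ j)
    {d a : ℕ} (hd : d * s ≤ 2) :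
    ∑ j ∈ nearDouble a, oddCost d a j * (g j / j !) ≤
      ((1 + 6 * C ^ 3 * s * d) / 2) ^ a * (b ^ 2) ^ a *
        edgeWeight C ((1 / c + 1 + 6 * C) / s) a / a ! := by
  have hb : 0 < b := lt_of_lt_of_le (by positivity) hcb
  have hg' : ∀ j, 3 ≤ j → g j / j ! ≤ (C * b) ^ j := fun j hj => by
    rw [div_le_iff₀ (by positivity), mul_comm]; exact hg j hj
  unfold nearDouble edgeWeight
  split_ifs with h0 h1 h2 h3 h4
  · subst h0; simpa [oddCost] using hg0
  · omega
  · subst h2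
    rw [Finset.sum_pair (by norm_num)]
    have := hg' 3 le_rfl
    simp only [oddCost]
    norm_num [Nat.factorial] at this ⊢
    have h6 : 3 * (d : ℝ) * (g 3 / 6) ≤ 3 * d * (C ^ 3 * b ^ 2 * s) := by
      refine mul_le_mul_of_nonneg_left (this.trans ?_) (by positivity)
      rw [mul_pow]
      have : b ^ 3 ≤ b ^ 2 * s := by rw [pow_succ]; gcongr
      calc C ^ 3 * b ^ 3 ≤ C ^ 3 * (b ^ 2 * s) := by gcongr
        _ = _ := by ring
    nlinarith
  · omega
  · omega
  · have ha : 2 ≤ a := by omega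
    rw [Finset.sum_insert (by
        simp only [Finset.mem_insert, Finset.mem_singleton]; omega),
      Finset.sum_pair (by omega)]
    have o1 : oddCost d a (2 * a - 1) = 1 := by unfold oddCost; rw [if_neg (by omega)]
    have o2 : oddCost d a (2 * a) = 1 := by unfold oddCost; rw [if_neg (by omega)]
    have o3 : oddCost d a (2 * a + 1) = 3 * d := by unfold oddCost; rw [if_pos rfl]
    rw [o1, o2, o3, one_mul, one_mul]
    have b1 := hg' (2 * a - 1) (by omega)
    have b2 := hg' (2 * a) (by omega)
    have b3 := hg' (2 * a + 1) (by omega)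
    set P := (C * b) ^ (2 * a) with hP
    have hP0 : 0 < P := by positivity
    have e1 : (C * b) ^ (2 * a - 1) = P * (1 / (C * b)) := by
      rw [hP, show 2 * a = 2 * a - 1 + 1 by omega, pow_succ, Nat.add_sub_cancel]; field_simp
    have e3 : (C * b) ^ (2 * a + 1) = P * (C * b) := pow_succ _ _
    -- Multiplicity 2a - 1 lacks one factor b compared with 2a; the lower bound on b compensates for
    -- it.
    have q1 : 1 / (C * b) ≤ (1 / c) / s := by
      rw [div_div]; exact one_div_le_one_div_of_le (by positivity) (by nlinarith)
    have q2 : (1 : ℝ) ≤ 1 / s := by rw [le_div_iff₀ hs]; linarith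
    have q3 : 3 * d * (C * b) ≤ 6 * C / s := by
      have : 3 * d * (C * b) ≤ 6 * C := by
        calc 3 * d * (C * b) ≤ 3 * d * (C * s) := by gcongr
          _ = 3 * C * (d * s) := by ring
          _ ≤ 3 * C * 2 := by gcongr
          _ = 6 * C := by ring
      refine this.trans ?_
      rw [le_div_iff₀ hs]; nlinarith
    have hd0 : (0 : ℝ) ≤ 3 * d := by positivity
    have lhs : g (2 * a - 1) / (2 * a - 1)! + (g (2 * a) / (2 * a)! +
        3 * d * (g (2 * a + 1) / (2 * a + 1)!)) ≤ P * ((1 / c + 1 + 6 * C) / s) := by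
      calc _ ≤ P * (1 / (C * b)) + (P + 3 * d * (P * (C * b))) := by
            rw [← e1, ← e3]; gcongr
        _ = P * (1 / (C * b) + 1 + 3 * d * (C * b)) := by ring
        _ ≤ P * (1 / c / s + 1 / s + 6 * C / s) := by gcongr
        _ = _ := by ring
    refine lhs.trans ?_
    have hfac : (a ! : ℝ) ≠ 0 := by positivity
    have : ((1 + 6 * C ^ 3 * s * d) / 2) ^ a * (b ^ 2) ^ a *
        (a ! * (2 * C ^ 2) ^ a * ((1 / c + 1 + 6 * C) / s)) / a ! =
        (1 + 6 * C ^ 3 * s * d) ^ a * P * ((1 / c + 1 + 6 * C) / s) := by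
      rw [hP, pow_mul, mul_pow C b 2, mul_pow (C ^ 2), div_pow, mul_pow 2]
      field_simp
    rw [this]
    refine mul_le_mul_of_nonneg_right ?_ (by positivity)
    refine le_mul_of_one_le_left hP0.le (one_le_pow₀ ?_)
    have : (0 : ℝ) ≤ 6 * C ^ 3 * s * d := by positivity
    linarith

/-- `vertexWeight` is designed for this: it cancels (d-1)!, supplies (2d)!, and hands one factor
(1+θd)/2 to each of the d departures from the vertex. -/
theorem trailLowerBound_mul_walkWeight (S : V × V → ℝ) (θ : ℝ) (η : ℕ → ℝ) (α : V × V → ℕ) :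
    trailLowerBound α * walkWeight S (vertexWeight θ) η α = (∏ x, ((2 * outDeg α x)! : ℝ)) *
      ∏ e, (((1 + θ * outDeg α e.1) / 2) ^ α e * S e ^ α e * η (α e) / (α e)!) := by
  have h1 : ∏ e, ((1 + θ * outDeg α e.1) / 2) ^ α e
      = ∏ x, ((1 + θ * outDeg α x) / 2) ^ outDeg α x := by
    rw [Fintype.prod_prod_type]
    exact Finset.prod_congr rfl fun x _ =>
      Finset.prod_pow_eq_pow_sum Finset.univ (fun z => α (x, z)) ((1 + θ * outDeg α x) / 2)
  have h2 : ∏ x, vertexWeight θ (outDeg α x) = (∏ x, ((2 * outDeg α x)! : ℝ)) /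
      (∏ x, ((outDeg α x - 1)! : ℝ)) * ∏ x, ((1 + θ * outDeg α x) / 2) ^ outDeg α x := by
    rw [← Finset.prod_div_distrib, ← Finset.prod_mul_distrib]
    refine Finset.prod_congr rfl fun x _ => ?_
    unfold vertexWeight
    rw [div_pow]
    field_simp
  rw [walkWeight, trailLowerBound, Finset.prod_div_distrib, Finset.prod_mul_distrib,
    Finset.prod_mul_distrib, h1, h2]
  have : (∏ x, ((outDeg α x - 1)! : ℝ)) ≠ 0 := by positivity
  field_simp

/-- The sum over pairs of walks that governs the expected Frobenius norm of a power of a random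
matrix with entries of size between `c s` and `s`. -/
theorem sum_pairs_le {C c s : ℝ} {b : V × V → ℝ} {g : V × V → ℕ → ℝ} (hC : 1 ≤ C) (hc : 0 < c)
    (hs : 0 < s) (hcb : ∀ e, c * s ≤ b e) (hbs : ∀ e, b e ≤ s)
    (hrow : ∀ x, ∑ z, b (x, z) ^ 2 ≤ 1) (hg : ∀ e j, 0 ≤ g e j)
    (hg0 : ∀ e, g e 0 ≤ 1) (hg1 : ∀ e, g e 1 = 0) (hg2 : ∀ e, g e 2 ≤ b e ^ 2)
    (hg3 : ∀ e j, 3 ≤ j → g e j ≤ j ! * (C * b e) ^ j) {k : ℕ} (hk : 1 ≤ k)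
    (hks : 1728 * C ^ 4 * (1 / c + 1 + 6 * C) * (k * s) ≤ 1) (u : V) :
    ∑ p : VertexSeq V k, ∑ q : VertexSeq V k, (if lastVertex u p = lastVertex u q then
        ∏ e, g e (edgeCount u p e + edgeCount u q e) else 0) ≤ (2 * k + 1) * (2 * Real.exp 2) := by
  set Q := 1 / c + 1 + 6 * C with hQ
  have hc' : 0 < 1 / c := by positivity
  have hQ1 : 7 ≤ Q := by linarith
  have hk1 : (1 : ℝ) ≤ k := by exact_mod_cast hk
  have hC3 : 1 ≤ C ^ 3 := one_le_pow₀ hC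
  have hC4 : C ^ 3 ≤ C ^ 4 := pow_le_pow_right₀ hC (by norm_num)
  have hks0 : 0 < k * s := by positivity
  have hks1 : 12096 * C ^ 3 * (k * s) ≤ 1 := by
    refine le_trans ?_ hks
    calc 12096 * C ^ 3 * (k * s) ≤ 12096 * C ^ 4 * (k * s) := by gcongr
      _ = 1728 * C ^ 4 * 7 * (k * s) := by ring
      _ ≤ _ := by gcongr
  have hks2 : 12096 * (k * s) ≤ 1 := by nlinarith
  have hs1 : s ≤ 1 := by nlinarith
  set θ := 6 * C ^ 3 * s with hθ
  have hθ0 : 0 ≤ θ := by positivity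
  have hθk : θ * (2 * k) ≤ 1 := by rw [hθ]; nlinarith
  have hR : 0 < Q / s := by positivity
  have hv := vertexWeight_pos hθ0
  have hη := edgeWeight_pos (by linarith : 0 < C) hR
  have hb0 : ∀ e, 0 ≤ b e := fun e => le_trans (by positivity) (hcb e)
  have hS : ∀ e, 0 ≤ b e ^ 2 := fun e => by positivity
  have hmain := sum_pairs_le_sum_walks g hg hg1 k u
    (walkWeight (fun e => b e ^ 2) (vertexWeight θ) (edgeWeight C (Q / s)))
    (walkWeight_nonneg hS hv hη) (fun α hα => by
      rw [trailLowerBound_mul_walkWeight]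
      refine mul_le_mul_of_nonneg_left (Finset.prod_le_prod (fun e _ => ?_) fun e _ => ?_)
        (by positivity)
      · exact Finset.sum_nonneg fun j _ => mul_nonneg (oddCost_nonneg _ _ _)
          (div_nonneg (hg e j) (by positivity))
      · refine sum_oddCost_le hC hc hs hs1 (hcb e) (hbs e) (hg0 e) (hg2 e) (hg3 e) ?_
        have h1 : outDeg α e.1 ≤ 2 * k := by
          refine le_trans ?_ hα
          rw [← sum_outDeg]
          exact Finset.single_le_sum (f := fun x => outDeg α x) (fun _ _ => Nat.zero_le _)
            (Finset.mem_univ _)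
        have h2 : (outDeg α e.1 : ℝ) ≤ 2 * k := by exact_mod_cast h1
        nlinarith)
  have hN : ((2 * k : ℕ) : ℝ) = 2 * k := by push_cast; ring
  have hwalk : ∀ L ∈ Finset.range (2 * k + 1), ∑ c : VertexSeq V L,
      walkWeight (fun e => b e ^ 2) (vertexWeight θ) (edgeWeight C (Q / s)) (edgeCount u c) ≤
        2 * Real.exp 2 := by
    intro L hL
    have := sum_walkWeight_add_le (V := V) (S := fun e => b e ^ 2) (v := vertexWeight θ)
      (η := edgeWeight C (Q / s)) (θ := θ) (σ := s ^ 2) (Q := 8 * C ^ 4 * (Q / s)) (N := 2 * k)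
      hS (fun e => by have := hb0 e; have := hbs e; gcongr) hrow hv hη hθ0
      (by
        have : 1 ≤ Q / s := by rw [le_div_iff₀ hs]; linarith
        nlinarith) (by positivity)
      (by
        rw [hN]
        calc 108 * (8 * C ^ 4 * (Q / s)) * s ^ 2 * (2 * k) = 1728 * C ^ 4 * Q * (k * s) := by
              field_simp; ring
          _ ≤ 1 := hks)
      (vertexWeight_one θ).le
      (fun a ha haN => vertexWeight_succ_le hθ0 ha (by
        have : (a + 1 : ℝ) ≤ 2 * k := by exact_mod_cast haN
        nlinarith))
      (by simp [edgeWeight])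
      (fun a ha haN => edgeWeight_succ_le hC hR ha (by
        have : (a + 1 : ℝ) ≤ 2 * k := by exact_mod_cast haN
        have h3 : 2 * (k : ℝ) ≤ Q / s := by rw [le_div_iff₀ hs]; nlinarith
        have : 1 ≤ C ^ 2 := one_le_pow₀ hC
        nlinarith))
      L 0 u (fun x z h => by simp at h) (by
        have := Finset.mem_range.1 hL
        simp; omega)
    simp only [zero_add] at this
    refine this.trans ?_
    have w0 : walkWeight (fun e => b e ^ 2) (vertexWeight θ) (edgeWeight C (Q / s)) 0 = 1 := by
      simp [walkWeight, outDeg, vertexWeight, edgeWeight]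
    rw [w0, if_pos (by simp [outDeg]), one_mul, hN]
    have hθ1 : θ ≤ 1 := by nlinarith
    have hL' : (L : ℝ) ≤ 2 * k := by
      have := Finset.mem_range.1 hL
      exact_mod_cast Nat.lt_succ_iff.1 this
    calc (1 + θ) * (1 + θ + 108 * s ^ 2 * (2 * k)) ^ L
        ≤ 2 * Real.exp (θ + 108 * s ^ 2 * (2 * k)) ^ L := by
          gcongr
          · linarith
          · linarith [Real.add_one_le_exp (θ + 108 * s ^ 2 * (2 * k))]
      _ = 2 * Real.exp (L * (θ + 108 * s ^ 2 * (2 * k))) := by rw [← Real.exp_nat_mul]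
      _ ≤ 2 * Real.exp 2 := by
          gcongr
          calc (L : ℝ) * (θ + 108 * s ^ 2 * (2 * k))
              ≤ 2 * k * (θ + 108 * s ^ 2 * (2 * k)) := by gcongr
            _ = θ * (2 * k) + 432 * (k * s) * (k * s) := by ring
            _ ≤ 2 := by nlinarith
  refine hmain.trans ((Finset.sum_le_sum hwalk).trans (le_of_eq ?_))
  simp

end ConcreteWeights

/-! ### Expected Frobenius norm of powers of a random matrix -/

section RandomMatrixPowers

open scoped Nat Classical

variable {V : Type} [Fintype V] [DecidableEq V] {Ω : Type*} [MeasurableSpace Ω] {μ : Measure Ω}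

theorem matrix_pow_apply_eq_sum (A : Matrix V V ℂ) : ∀ (k : ℕ) (u v : V),
    (A ^ k) u v = ∑ p : VertexSeq V k,
      (if lastVertex u p = v then ∏ e : V × V, A e.1 e.2 ^ edgeCount u p e else 0)
  | 0, u, v => by
    rw [VertexSeq.sum_zero, pow_zero, Matrix.one_apply]
    simp [lastVertex, edgeCount]
  | k + 1, u, v => by
    rw [pow_succ', Matrix.mul_apply, VertexSeq.sum_succ]
    refine Finset.sum_congr rfl fun z _ => ?_
    rw [matrix_pow_apply_eq_sum A k z v, Finset.mul_sum]
    refine Finset.sum_congr rfl fun p _ => ?_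
    simp only [lastVertex, edgeCount, mul_ite, mul_zero]
    congr 1
    simp only [Pi.add_apply, pow_add, Finset.prod_mul_distrib]
    congr 1
    rw [Finset.prod_eq_single (u, z)]
    · simp
    · intro e _ he; simp [Pi.single_eq_of_ne he]
    · simp

theorem integrable_prod_of_iIndepFun {ι : Type*} [Fintype ι] {Y : ι → Ω → ℂ}
    (hY : iIndepFun Y μ) (hint : ∀ i, Integrable (Y i) μ) :
    Integrable (fun ω => ∏ i, Y i ω) μ := by
  have := hY.isProbabilityMeasure
  have hm : ∀ i, AEMeasurable (Y i) μ := fun i => (hint i).aemeasurable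
  have : ∀ i, IsProbabilityMeasure (μ.map (Y i)) := fun i =>
    Measure.isProbabilityMeasure_map (hm i)
  have h1 : Integrable (fun x : ι → ℂ => ∏ i, x i) (Measure.pi fun i => μ.map (Y i)) :=
    Integrable.fintype_prod (f := fun _ x => x) fun i =>
      (integrable_map_measure aestronglyMeasurable_id (hm i)).2 (hint i)
  rw [← hY.map_fun_eq_pi_map hm] at h1
  exact h1.comp_aemeasurable (aemeasurable_pi_lambda _ hm)

theorem pow_self_le_factorial_mul_exp_pow (j : ℕ) : (j : ℝ) ^ j ≤ j ! * Real.exp 1 ^ j := by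
  have := Real.pow_div_factorial_le_exp (j : ℝ) (by positivity) j
  rw [div_le_iff₀ (by positivity)] at this
  rw [← Real.exp_nat_mul, mul_one, mul_comm]
  exact this

/-- The absolute moments of `a`, except that the zeroth moment is `1` and the first one is
replaced by `0`. -/
noncomputable def mixedMomentBound (μ : Measure Ω) (a : Ω → ℂ) (j : ℕ) : ℝ :=
  if j = 0 then 1 else if j = 1 then 0 else ∫ ω, ‖a ω‖ ^ j ∂μ

theorem mixedMomentBound_nonneg (a : Ω → ℂ) (j : ℕ) : 0 ≤ mixedMomentBound μ a j := by
  unfold mixedMomentBound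
  split_ifs
  · exact zero_le_one
  · exact le_rfl
  · exact integral_nonneg fun ω => by positivity

/-- Centring kills both mixed moments of total order one; beyond that the triangle inequality is
enough. -/
theorem norm_integral_pow_mul_conj_pow_le [IsProbabilityMeasure μ] {a : Ω → ℂ}
    (h : ∫ ω, a ω ∂μ = 0) (i j : ℕ) :
    ‖∫ ω, a ω ^ i * (starRingEnd ℂ) (a ω) ^ j ∂μ‖ ≤ mixedMomentBound μ a (i + j) := by
  unfold mixedMomentBound
  split_ifs with h0 h1
  · obtain ⟨rfl, rfl⟩ : i = 0 ∧ j = 0 := by omega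
    simp
  · have : (i = 1 ∧ j = 0) ∨ (i = 0 ∧ j = 1) := by omega
    rcases this with ⟨rfl, rfl⟩ | ⟨rfl, rfl⟩
    · simp [h]
    · simp only [pow_zero, one_mul, pow_one]
      rw [integral_conj, h]
      simp
  · refine (norm_integral_le_integral_norm _).trans (le_of_eq ?_)
    simp [pow_add]

theorem integral_sum_sq_norm_pow_le [IsProbabilityMeasure μ] {Y : V × V → Ω → ℂ}
    (hind : iIndepFun Y μ) (hmeas : ∀ e, Measurable (Y e))
    (hint : ∀ e j, Integrable (fun ω => ‖Y e ω‖ ^ j) μ) (hmean : ∀ e, ∫ ω, Y e ω ∂μ = 0)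
    (b : V × V → ℝ) (k : ℕ) (u : V) :
    Integrable (fun ω => ∑ v, ‖(Matrix.of (fun i j => (b (i, j) : ℂ) * Y (i, j) ω) ^ k) u v‖ ^ 2) μ ∧
    ∫ ω, ∑ v, ‖(Matrix.of (fun i j => (b (i, j) : ℂ) * Y (i, j) ω) ^ k) u v‖ ^ 2 ∂μ ≤
      ∑ p : VertexSeq V k, ∑ q : VertexSeq V k, (if lastVertex u p = lastVertex u q then
        ∏ e, mixedMomentBound μ (fun ω => (b e : ℂ) * Y e ω)
          (edgeCount u p e + edgeCount u q e) else 0) := by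
  set a : V × V → Ω → ℂ := fun e ω => (b e : ℂ) * Y e ω with ha
  set F : (V × V → ℕ) → (V × V → ℕ) → V × V → ℂ → ℂ := fun m m' e z =>
    ((b e : ℂ) * z) ^ m e * (starRingEnd ℂ) ((b e : ℂ) * z) ^ m' e with hF
  have hFm : ∀ m m' e, Measurable (F m m' e) := fun m m' e => by
    have : Continuous (F m m' e) := by
      simp only [hF]
      exact ((continuous_const.mul continuous_id).pow _).mul
        ((Complex.continuous_conj.comp (continuous_const.mul continuous_id)).pow _)
    exact this.measurable
  have hcomp : ∀ m m', iIndepFun (fun e => F m m' e ∘ Y e) μ := fun m m' =>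
    hind.comp _ (hFm m m')
  have hintF : ∀ m m' e, Integrable (F m m' e ∘ Y e) μ := fun m m' e => by
    refine ((hint e (m e + m' e)).const_mul (|b e| ^ (m e + m' e))).mono
      ((hFm m m' e).comp (hmeas e)).aestronglyMeasurable (Filter.Eventually.of_forall fun ω => ?_)
    refine le_of_eq ?_
    simp [hF, pow_add, mul_pow]
    ring
  have hprodint : ∀ m m', Integrable (fun ω => ∏ e, (F m m' e ∘ Y e) ω) μ := fun m m' =>
    integrable_prod_of_iIndepFun (hcomp m m') (hintF m m')
  have hprod : ∀ m m', ‖∫ ω, ∏ e, (F m m' e ∘ Y e) ω ∂μ‖ ≤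
      ∏ e, mixedMomentBound μ (a e) (m e + m' e) := fun m m' => by
    rw [(hcomp m m').integral_fun_prod_eq_prod_integral fun e => (hintF m m' e).aestronglyMeasurable,
      norm_prod]
    refine Finset.prod_le_prod (fun e _ => norm_nonneg _) fun e _ => ?_
    refine norm_integral_pow_mul_conj_pow_le (a := a e) ?_ (m e) (m' e)
    simp only [ha]
    rw [integral_const_mul, hmean, mul_zero]
  have hexp : ∀ ω, ((∑ v, ‖(Matrix.of (fun i j => (b (i, j) : ℂ) * Y (i, j) ω) ^ k) u v‖ ^ 2 : ℝ) : ℂ)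
      = ∑ p : VertexSeq V k, ∑ q : VertexSeq V k, (if lastVertex u p = lastVertex u q then
        ∏ e, (F (edgeCount u p) (edgeCount u q) e ∘ Y e) ω else 0) := by
    intro ω
    push_cast
    simp only [← Complex.mul_conj', matrix_pow_apply_eq_sum, map_sum, Finset.sum_mul_sum]
    rw [Finset.sum_comm]
    refine Finset.sum_congr rfl fun p _ => ?_
    rw [Finset.sum_comm]
    refine Finset.sum_congr rfl fun q _ => ?_
    rw [Finset.sum_eq_single (lastVertex u p)]
    · rw [if_pos rfl]
      by_cases h : lastVertex u p = lastVertex u q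
      · rw [if_pos h, if_pos h.symm, map_prod, ← Finset.prod_mul_distrib]
        exact Finset.prod_congr rfl fun e _ => by simp [hF]
      · rw [if_neg h, if_neg (fun h' => h h'.symm), map_zero, mul_zero]
    · intro v _ hv
      rw [if_neg (fun h => hv h.symm), zero_mul]
    · simp
  have hintsum : ∀ p q : VertexSeq V k, Integrable (fun ω =>
      (if lastVertex u p = lastVertex u q then
        ∏ e, (F (edgeCount u p) (edgeCount u q) e ∘ Y e) ω else 0)) μ := fun p q => by
    split_ifs
    · exact hprodint _ _
    · exact integrable_zero _ _ _
  have hI : Integrable (fun ω => ((∑ v, ‖(Matrix.of (fun i j =>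
      (b (i, j) : ℂ) * Y (i, j) ω) ^ k) u v‖ ^ 2 : ℝ) : ℂ)) μ := by
    simp only [hexp]
    exact integrable_finsetSum _ fun p _ => integrable_finsetSum _ fun q _ => hintsum p q
  refine ⟨hI.re, ?_⟩
  have hre : ∫ ω, ∑ v, ‖(Matrix.of (fun i j => (b (i, j) : ℂ) * Y (i, j) ω) ^ k) u v‖ ^ 2 ∂μ ≤
      ‖∫ ω, ((∑ v, ‖(Matrix.of (fun i j =>
        (b (i, j) : ℂ) * Y (i, j) ω) ^ k) u v‖ ^ 2 : ℝ) : ℂ) ∂μ‖ := by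
    rw [integral_complex_ofReal, Complex.norm_real]
    exact le_abs_self _
  refine hre.trans ?_
  simp only [hexp]
  rw [integral_finsetSum _ fun p _ => integrable_finsetSum _ fun q _ => hintsum p q]
  refine (norm_sum_le _ _).trans (Finset.sum_le_sum fun p _ => ?_)
  rw [integral_finsetSum _ fun q _ => hintsum p q]
  refine (norm_sum_le _ _).trans (Finset.sum_le_sum fun q _ => ?_)
  split_ifs
  · exact hprod _ _
  · simp

/-- A bound for the expected squared Frobenius norm of powers of a random matrix. -/
theorem integral_frobenius_pow_le [IsProbabilityMeasure μ] {Y : V × V → Ω → ℂ} {K C c s : ℝ}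
    {b : V × V → ℝ} (hK : 0 < K)
    (hind : iIndepFun Y μ) (hmeas : ∀ e, Measurable (Y e))
    (hint : ∀ e j, Integrable (fun ω => ‖Y e ω‖ ^ j) μ) (hmean : ∀ e, ∫ ω, Y e ω ∂μ = 0)
    (hvar : ∀ e, ∫ ω, ‖Y e ω‖ ^ 2 ∂μ = 1)
    (hmom : ∀ e, ∀ j : ℕ, 1 ≤ j → ∫ ω, ‖Y e ω‖ ^ j ∂μ ≤ (K * j) ^ j)
    (hC : 1 ≤ C) (hCK : K * Real.exp 1 ≤ C) (hc : 0 < c)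
    (hs : 0 < s) (hcb : ∀ e, c * s ≤ b e) (hbs : ∀ e, b e ≤ s)
    (hrow : ∀ x, ∑ z, b (x, z) ^ 2 ≤ 1) {k : ℕ} (hk : 1 ≤ k)
    (hks : 1728 * C ^ 4 * (1 / c + 1 + 6 * C) * (k * s) ≤ 1) :
    Integrable (fun ω => ∑ u, ∑ v,
      ‖(Matrix.of (fun i j => (b (i, j) : ℂ) * Y (i, j) ω) ^ k) u v‖ ^ 2) μ ∧
    ∫ ω, ∑ u, ∑ v, ‖(Matrix.of (fun i j => (b (i, j) : ℂ) * Y (i, j) ω) ^ k) u v‖ ^ 2 ∂μ ≤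
      Fintype.card V * ((2 * k + 1) * (2 * Real.exp 2)) := by
  have hb0 : ∀ e, 0 ≤ b e := fun e => le_trans (by positivity) (hcb e)
  have hmoment : ∀ e j, ∫ ω, ‖(b e : ℂ) * Y e ω‖ ^ j ∂μ = b e ^ j * ∫ ω, ‖Y e ω‖ ^ j ∂μ := by
    intro e j
    rw [← integral_const_mul]
    congr 1
    ext ω
    rw [norm_mul, mul_pow, Complex.norm_real, Real.norm_of_nonneg (hb0 e)]
  have key := integral_sum_sq_norm_pow_le hind hmeas hint hmean b k
  refine ⟨integrable_finsetSum _ fun u _ => (key u).1, ?_⟩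
  rw [integral_finsetSum _ fun u _ => (key u).1]
  refine (Finset.sum_le_card_nsmul _ _ ((2 * k + 1) * (2 * Real.exp 2)) fun u _ =>
    (key u).2.trans ?_).trans (le_of_eq (by rw [nsmul_eq_mul, Finset.card_univ]))
  refine sum_pairs_le hC hc hs hcb hbs hrow (fun e j => mixedMomentBound_nonneg _ j)
    (fun e => by simp [mixedMomentBound]) (fun e => by simp [mixedMomentBound]) (fun e => ?_)
    (fun e j hj => ?_) hk hks u
  · unfold mixedMomentBound
    rw [if_neg (by norm_num), if_neg (by norm_num), hmoment, hvar, mul_one]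
  · unfold mixedMomentBound
    rw [if_neg (by omega), if_neg (by omega), hmoment]
    have hb := hb0 e
    -- The moment bound becomes factorial growth through j^j ≤ j! e^j.
    calc b e ^ j * ∫ ω, ‖Y e ω‖ ^ j ∂μ ≤ b e ^ j * (K * j) ^ j := by
          gcongr; exact hmom e j (by omega)
      _ = b e ^ j * K ^ j * (j : ℝ) ^ j := by rw [mul_pow]; ring
      _ ≤ b e ^ j * K ^ j * (j ! * Real.exp 1 ^ j) := by
          gcongr; exact pow_self_le_factorial_mul_exp_pow j
      _ = j ! * (K * Real.exp 1 * b e) ^ j := by rw [mul_pow, mul_pow]; ring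
      _ ≤ j ! * (C * b e) ^ j := by gcongr

end RandomMatrixPowers

/-! ### Spectral radius, rescaling and subinvariant vectors -/

section SpectralRadius

attribute [local instance] Matrix.linftyOpNormedRing Matrix.linftyOpNormedAlgebra

/-- This is Gelfand's formula in the operator norm on ℓ∞, which is the maximal absolute row sum. -/
theorem exists_pow_mulVec_one_le {n : ℕ} {S : Matrix (Fin n) (Fin n) ℝ} {r : ℝ}
    (h : realMatrixSpectralRadius S < r) :
    ∃ J : ℕ, 1 ≤ J ∧ ∀ i, ∑ j, (S ^ J) i j ≤ r ^ J := by
  have hr : 0 ≤ r := le_trans ENNReal.toReal_nonneg h.le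
  set M : Matrix (Fin n) (Fin n) ℂ := S.map Complex.ofReal with hM
  have : CompleteSpace (Matrix (Fin n) (Fin n) ℂ) := FiniteDimensional.complete ℂ _
  have hlt : spectralRadius ℂ M < ENNReal.ofReal r :=
    (ENNReal.lt_ofReal_iff_toReal_lt (spectralRadius_matrix_ne_top M)).2 h
  have hev := (spectrum.pow_nnnorm_pow_one_div_tendsto_nhds_spectralRadius M).eventually_lt_const hlt
  obtain ⟨J, hJ, hJ1⟩ := (hev.and (Filter.eventually_ge_atTop 1)).exists
  refine ⟨J, hJ1, fun i => ?_⟩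
  have hJ0 : (J : ℝ) ≠ 0 := by positivity
  have hnorm : ‖M ^ J‖ ≤ r ^ J := by
    have h1 := ENNReal.rpow_le_rpow hJ.le (Nat.cast_nonneg J : (0 : ℝ) ≤ J)
    rw [← ENNReal.rpow_mul, one_div_mul_cancel hJ0, ENNReal.rpow_one, ENNReal.rpow_natCast,
      ← ENNReal.ofReal_pow hr] at h1
    have h2 := ENNReal.toReal_mono ENNReal.ofReal_ne_top h1
    rwa [ENNReal.toReal_ofReal (pow_nonneg hr J)] at h2
  have hrow : (∑ j, ‖(M ^ J) i j‖) ≤ ‖M ^ J‖ := by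
    rw [Matrix.linfty_opNorm_def]
    have := Finset.le_sup (f := fun i => ∑ j, ‖(M ^ J) i j‖₊) (Finset.mem_univ i)
    refine le_trans (le_of_eq ?_) (NNReal.coe_le_coe.2 this)
    simp
  refine le_trans (Finset.sum_le_sum fun j _ => ?_) (hrow.trans hnorm)
  have : M ^ J = (S ^ J).map Complex.ofReal := (Matrix.map_pow S Complex.ofRealHom J).symm
  rw [this, Matrix.map_apply, Complex.norm_real]
  exact le_abs_self _

theorem realMatrixSpectralRadius_le {n : ℕ} {S : Matrix (Fin n) (Fin n) ℝ} {B : ℝ} (hn : 1 ≤ n)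
    (h : ∀ i, ∑ j, |S i j| ≤ B) : realMatrixSpectralRadius S ≤ B := by
  have : CompleteSpace (Matrix (Fin n) (Fin n) ℂ) := FiniteDimensional.complete ℂ _
  have : Nonempty (Fin n) := ⟨⟨0, hn⟩⟩
  have hB : 0 ≤ B := (Finset.sum_nonneg fun j _ => abs_nonneg _).trans (h ⟨0, hn⟩)
  have h1 := spectrum.spectralRadius_le_nnnorm (𝕜 := ℂ) (S.map Complex.ofReal)
  have h2 := ENNReal.toReal_mono ENNReal.coe_ne_top h1
  refine le_trans h2 ?_
  rw [ENNReal.coe_toReal, Matrix.linfty_opNNNorm_def]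
  rw [← Real.coe_toNNReal B hB, NNReal.coe_le_coe]
  refine Finset.sup_le fun i _ => ?_
  rw [← NNReal.coe_le_coe, Real.coe_toNNReal B hB]
  push_cast
  simpa using h i

theorem exists_eigenvector {n : ℕ} (hn : 1 ≤ n) (M : Matrix (Fin n) (Fin n) ℂ) :
    ∃ (z : ℂ) (w : Fin n → ℂ), ‖z‖ = matrixSpectralRadius M ∧ w ≠ 0 ∧
      ∀ i, ∑ j, M i j * w j = z * w i := by
  have : CompleteSpace (Matrix (Fin n) (Fin n) ℂ) := FiniteDimensional.complete ℂ _
  have : Nonempty (Fin n) := ⟨⟨0, hn⟩⟩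
  obtain ⟨z, hz, hzn⟩ := spectrum.exists_nnnorm_eq_spectralRadius M
  have hz' : z ∈ spectrum ℂ (Matrix.toLin' M) := by
    have := Matrix.spectrum_toLin' M
    rw [this]; exact hz
  obtain ⟨w, hw⟩ := (Module.End.hasEigenvalue_iff_mem_spectrum.2 hz').exists_hasEigenvector
  refine ⟨z, w, ?_, hw.2, fun i => ?_⟩
  · rw [matrixSpectralRadius, ← hzn]; rfl
  · have := congrFun hw.apply_eq_smul i
    simpa [Matrix.mulVec, dotProduct] using this

end SpectralRadius

/-- A rescaling of the rows and columns of a matrix moves its spectral radius below the Frobenius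
norm of a power of the rescaled matrix. -/
theorem matrixSpectralRadius_pow_le {n : ℕ} (hn : 1 ≤ n) (M M' : Matrix (Fin n) (Fin n) ℂ)
    (d : Fin n → ℝ) (hd : ∀ i, d i ≠ 0) {R : ℝ} (hR : 0 < R)
    (h : ∀ i j, M' i j * (d i * R) = M i j * d j) (k : ℕ) :
    (matrixSpectralRadius M / R) ^ (2 * k) ≤ ∑ i, ∑ j, ‖(M' ^ k) i j‖ ^ 2 := by
  obtain ⟨z, w, hz, hw, hMw⟩ := exists_eigenvector hn M
  -- `M'` is D⁻¹MD/R with D = diag(d), so D⁻¹w is an eigenvector of it with eigenvalue z/R.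
  set w' : Fin n → ℂ := fun i => w i / d i with hw'
  have hdC : ∀ i, (d i : ℂ) ≠ 0 := fun i => Complex.ofReal_ne_zero.2 (hd i)
  have hRC : (R : ℂ) ≠ 0 := Complex.ofReal_ne_zero.2 hR.ne'
  have h1 : M'.mulVec w' = (z / R) • w' := by
    ext i
    rw [Matrix.mulVec, dotProduct, Pi.smul_apply, smul_eq_mul]
    have hterm : ∀ j, M' i j * w' j = M i j * w j / (d i * R) := by
      intro j
      rw [hw', eq_div_iff (mul_ne_zero (hdC i) hRC)]
      calc M' i j * (w j / d j) * (d i * R) = M' i j * (d i * R) * (w j / d j) := by ring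
        _ = M i j * d j * (w j / d j) := by rw [h]
        _ = _ := by field_simp [hdC j]
    simp only [hterm]
    rw [← Finset.sum_div, hMw, hw']
    field_simp [hdC i]
  have h2 : ∀ k : ℕ, (M' ^ k).mulVec w' = (z / R) ^ k • w' := by
    intro k
    induction k with
    | zero => simp
    | succ k ih =>
      rw [pow_succ, ← Matrix.mulVec_mulVec, h1, Matrix.mulVec_smul, ih, smul_smul, pow_succ, mul_comm]
  obtain ⟨i₀, hi₀⟩ : ∃ i, w' i ≠ 0 := by
    obtain ⟨i, hi⟩ := Function.ne_iff.1 hw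
    exact ⟨i, div_ne_zero hi (hdC i)⟩
  have hpos : 0 < ∑ j, ‖w' j‖ ^ 2 :=
    Finset.sum_pos' (fun j _ => by positivity) ⟨i₀, Finset.mem_univ _, by positivity⟩
  have hentry : ∀ i, (matrixSpectralRadius M / R) ^ (2 * k) * ‖w' i‖ ^ 2 ≤
      (∑ j, ‖(M' ^ k) i j‖ ^ 2) * ∑ j, ‖w' j‖ ^ 2 := by
    intro i
    have h3 := congrFun (h2 k) i
    rw [Matrix.mulVec, dotProduct, Pi.smul_apply, smul_eq_mul] at h3
    have h4 : ‖(z / R) ^ k * w' i‖ ≤ ∑ j, ‖(M' ^ k) i j‖ * ‖w' j‖ := by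
      rw [← h3]
      exact (norm_sum_le _ _).trans (le_of_eq (Finset.sum_congr rfl fun j _ => norm_mul _ _))
    have h5 : ‖(z / R) ^ k * w' i‖ = (matrixSpectralRadius M / R) ^ k * ‖w' i‖ := by
      rw [norm_mul, norm_pow, norm_div, hz, Complex.norm_real, Real.norm_of_nonneg hR.le]
    calc (matrixSpectralRadius M / R) ^ (2 * k) * ‖w' i‖ ^ 2
        = ‖(z / R) ^ k * w' i‖ ^ 2 := by rw [h5]; ring
      _ ≤ (∑ j, ‖(M' ^ k) i j‖ * ‖w' j‖) ^ 2 := pow_le_pow_left₀ (norm_nonneg _) h4 2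
      _ ≤ _ := Finset.sum_mul_sq_le_sq_mul_sq _ _ _
  have hsum := Finset.sum_le_sum fun i (_ : i ∈ Finset.univ) => hentry i
  rw [← Finset.mul_sum, ← Finset.sum_mul] at hsum
  exact le_of_mul_le_mul_right hsum hpos

/-- Above the spectral radius, a matrix with comparable entries has a positive subinvariant vector
with comparable entries. -/
theorem exists_subinvariant_vector {n : ℕ} (hn : 1 ≤ n) {S : Matrix (Fin n) (Fin n) ℝ} {c C r : ℝ}
    (hc : 0 < c) (hcC : c ≤ C) (hS : ∀ i j, c / n ≤ S i j ∧ S i j ≤ C / n)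
    (hr : realMatrixSpectralRadius S < r) :
    ∃ x : Fin n → ℝ, (∀ i, 0 < x i) ∧ (∀ i j, x i ≤ C / c * x j) ∧
      ∀ i, ∑ j, S i j * x j ≤ r * x i := by
  have hr0 : 0 < r := lt_of_le_of_lt ENNReal.toReal_nonneg hr
  have hn0 : (0 : ℝ) < n := by exact_mod_cast hn
  obtain ⟨J, hJ, hJr⟩ := exists_pow_mulVec_one_le hr
  set w : ℕ → Fin n → ℝ := fun m i => ∑ j, (S ^ m) i j with hw
  have hw0 : ∀ i, w 0 i = 1 := fun i => by simp [hw, Matrix.one_apply]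
  have hwS : ∀ m i, w (m + 1) i = ∑ j, S i j * w m j := by
    intro m i
    simp only [hw, pow_succ', Matrix.mul_apply, Finset.mul_sum]
    exact Finset.sum_comm
  have hSnn : ∀ i j, 0 ≤ S i j := fun i j => le_trans (by positivity) (hS i j).1
  have hwc : ∀ m i, c ^ m ≤ w m i := by
    intro m
    induction m with
    | zero => intro i; rw [hw0, pow_zero]
    | succ m ih =>
      intro i
      rw [hwS]
      calc c ^ (m + 1) = ∑ _j : Fin n, c / n * c ^ m := by
            rw [Finset.sum_const, Finset.card_univ, Fintype.card_fin, nsmul_eq_mul]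
            field_simp
            ring
        _ ≤ _ := Finset.sum_le_sum fun j _ =>
            mul_le_mul (hS i j).1 (ih j) (by positivity) (hSnn i j)
  have hwpos : ∀ m i, 0 < w m i := fun m i => lt_of_lt_of_le (by positivity) (hwc m i)
  have hCc : 1 ≤ C / c := by rw [le_div_iff₀ hc]; linarith
  -- The vector is ∑_{m<J} r^{-m} S^m 1, which makes an exact Perron vector unnecessary.
  refine ⟨fun i => ∑ m ∈ Finset.range J, w m i / r ^ m, fun i => ?_, fun i j => ?_, fun i => ?_⟩
  · exact Finset.sum_pos (fun m _ => div_pos (hwpos m i) (by positivity))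
      ⟨0, Finset.mem_range.2 hJ⟩
  · rw [Finset.mul_sum]
    refine Finset.sum_le_sum fun m _ => ?_
    rw [← mul_div_assoc]
    refine div_le_div_of_nonneg_right ?_ (by positivity)
    -- For positive powers, comparability comes from the leftmost factor S, whose rows are
    -- comparable entrywise.
    cases m with
    | zero => rw [hw0, hw0]; linarith
    | succ m =>
      rw [hwS, hwS, Finset.mul_sum]
      refine Finset.sum_le_sum fun l _ => ?_
      rw [← mul_assoc]
      refine mul_le_mul_of_nonneg_right ?_ (hwpos m l).le
      calc S i l ≤ C / n := (hS i l).2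
        _ = C / c * (c / n) := by field_simp
        _ ≤ C / c * S j l := mul_le_mul_of_nonneg_left (hS j l).1 (by positivity)
  · have e1 : ∑ j, S i j * ∑ m ∈ Finset.range J, w m j / r ^ m
        = r * ∑ m ∈ Finset.range J, w (m + 1) i / r ^ (m + 1) := by
      simp only [Finset.mul_sum, hwS, Finset.sum_div]
      rw [Finset.sum_comm]
      refine Finset.sum_congr rfl fun m _ => Finset.sum_congr rfl fun j _ => ?_
      rw [pow_succ]; field_simp
    rw [e1]
    refine mul_le_mul_of_nonneg_left ?_ hr0.le
    -- Applying S/r shifts the series: the term 1 is lost and r^{-J} S^J 1 ≤ 1 is gained.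
    have e2 := Finset.sum_range_succ' (fun m => w m i / r ^ m) J
    rw [Finset.sum_range_succ] at e2
    have e3 : w J i / r ^ J ≤ 1 := by
      rw [div_le_one (by positivity)]; exact hJr i
    rw [hw0, pow_zero] at e2
    linarith

/-! ### Markov's inequality and the choice of the exponent -/

theorem exp_half_le_one_add {y : ℝ} (h0 : 0 ≤ y) (h1 : y ≤ 1) : Real.exp (y / 2) ≤ 1 + y := by
  have h2 : |y / 2| ≤ 1 := by rw [abs_of_nonneg (by linarith)]; linarith
  have := (abs_le.1 (Real.abs_exp_sub_one_sub_id_le h2)).2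
  nlinarith

/-- The moment method bound, with the exponent `k` still free. -/
theorem measure_matrixSpectralRadius_ge_le {n : ℕ} (hn : 1 ≤ n) {Ω : Type*} [MeasurableSpace Ω]
    {μ : Measure Ω} [IsProbabilityMeasure μ] {X : Ω → Matrix (Fin n) (Fin n) ℂ} {K c C D₀ R h : ℝ}
    (hX : IsSubexponentialModel μ K X) (hK : 0 < K) {b : Matrix (Fin n) (Fin n) ℝ}
    (hb : ∀ i j, 0 ≤ b i j) (hc : 0 < c) (hcC : c ≤ C)
    (hflat : ∀ i j, c / n ≤ b i j ^ 2 ∧ b i j ^ 2 ≤ C / n) (hR : 0 < R)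
    (hρ : realMatrixSpectralRadius (varianceMatrix b) < R ^ 2) (hh : 0 ≤ h)
    (hD₀ : 1 ≤ D₀) (hKD : K * Real.exp 1 ≤ D₀) (k : ℕ)
    (hk : 1728 * D₀ ^ 4 * (1 / √((c / C) ^ 3) + 1 + 6 * D₀) * (k * (C / (√c * √n * R))) ≤ 1) :
    μ.real {ω | R + h ≤ matrixSpectralRadius (inhomogeneousMatrix b X ω)} ≤
      n * ((2 * k + 1) * (2 * Real.exp 2)) / (1 + h / R) ^ (2 * k) := by
  have hn0 : (0 : ℝ) < n := by exact_mod_cast hn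
  have hn1 : (1 : ℝ) ≤ n := by exact_mod_cast hn
  have hC : 0 < C := hc.trans_le hcC
  -- For k = 0 the right-hand side is at least 1.
  rcases Nat.eq_zero_or_pos k with rfl | hkpos
  · have h1 : (1 : ℝ) ≤ Real.exp 2 := Real.one_le_exp (by norm_num)
    refine measureReal_le_one.trans ?_
    simp only [Nat.cast_zero, mul_zero, pow_zero, div_one, zero_add, one_mul]
    nlinarith
  obtain ⟨x, hx0, hxC, hxS⟩ := exists_subinvariant_vector hn (S := varianceMatrix b) hc hcC
    (fun i j => hflat i j) hρ
  -- Since x_j/x_i lies between c/C and C/c, the squared rescaled entries lie between (c/C)³ s² and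
  -- s².
  set s := C / (√c * √n * R) with hs
  have hsc : 0 < √c := Real.sqrt_pos.2 hc
  have hsn : 0 < √(n : ℝ) := Real.sqrt_pos.2 hn0
  have hs0 : 0 < s := by positivity
  have hs2 : s ^ 2 = C ^ 2 / (c * n * R ^ 2) := by
    rw [hs, div_pow, mul_pow, mul_pow, Real.sq_sqrt hc.le, Real.sq_sqrt hn0.le]
  set d : Fin n → ℝ := fun i => √(x i) with hd
  have hd0 : ∀ i, 0 < d i := fun i => Real.sqrt_pos.2 (hx0 i)
  have hd2 : ∀ i, d i ^ 2 = x i := fun i => Real.sq_sqrt (hx0 i).le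
  set b' : Fin n × Fin n → ℝ := fun e => b e.1 e.2 * d e.2 / (d e.1 * R) with hb'
  have hb'0 : ∀ e, 0 ≤ b' e := fun e =>
    div_nonneg (mul_nonneg (hb _ _) (hd0 _).le) (mul_pos (hd0 _) hR).le
  have hb'2 : ∀ i j, b' (i, j) ^ 2 = b i j ^ 2 * (x j / x i) / R ^ 2 := by
    intro i j
    simp only [hb']
    rw [div_pow, mul_pow, mul_pow, hd2, hd2]
    field_simp
  have hratio : ∀ i j, x j / x i ≤ C / c := fun i j => by
    rw [div_le_iff₀ (hx0 i)]; exact hxC j i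
  have hratio' : ∀ i j, c / C ≤ x j / x i := fun i j => by
    rw [div_le_div_iff₀ hC (hx0 i)]
    have := hxC i j
    rw [div_mul_eq_mul_div, le_div_iff₀ hc] at this
    linarith
  have hfrob := integral_frobenius_pow_le (μ := μ) (Y := fun e ω => X ω e.1 e.2) (K := K)
    (C := D₀) (c := √((c / C) ^ 3)) (s := s) (b := b') hK hX.indep
    (fun e => hX.measurable_entry _ _) (fun e j => by
      rcases Nat.eq_zero_or_pos j with rfl | hj
      · simp
      · exact hX.integrable_moment _ _ j hj)
    (fun e => hX.mean_zero _ _) (fun e => hX.second_moment _ _)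
    (fun e j hj => hX.moment_le _ _ j hj) hD₀ hKD (by positivity) hs0
    (fun ⟨i, j⟩ => by
      refine (pow_le_pow_iff_left₀ (by positivity) (hb'0 _) two_ne_zero).1 ?_
      rw [mul_pow, Real.sq_sqrt (by positivity), hb'2, hs2]
      have h1 := mul_le_mul (hflat i j).1 (hratio' i j) (by positivity) (by positivity)
      calc (c / C) ^ 3 * (C ^ 2 / (c * n * R ^ 2)) = c / n * (c / C) / R ^ 2 := by
            field_simp
        _ ≤ _ := by gcongr)
    (fun ⟨i, j⟩ => by
      refine (pow_le_pow_iff_left₀ (hb'0 _) hs0.le two_ne_zero).1 ?_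
      rw [hb'2, hs2]
      have h1 := mul_le_mul (hflat i j).2 (hratio i j) (div_pos (hx0 j) (hx0 i)).le (by positivity)
      calc b i j ^ 2 * (x j / x i) / R ^ 2 ≤ C / n * (C / c) / R ^ 2 := by gcongr
        _ = _ := by field_simp)
    (fun i => by
      simp only [hb'2]
      have h1 := hxS i
      simp only [varianceMatrix, Matrix.of_apply] at h1
      calc ∑ j, b i j ^ 2 * (x j / x i) / R ^ 2 = (∑ j, b i j ^ 2 * x j) / (R ^ 2 * x i) := by
            rw [Finset.sum_div]
            refine Finset.sum_congr rfl fun j _ => ?_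
            field_simp
        _ ≤ 1 := by
            rw [div_le_one (mul_pos (by positivity) (hx0 i))]; exact h1)
    hkpos hk
  rw [Fintype.card_fin] at hfrob
  set F : Ω → ℝ := fun ω => ∑ i, ∑ j,
    ‖(Matrix.of (fun i j => (b' (i, j) : ℂ) * X ω i j) ^ k) i j‖ ^ 2 with hF
  have hF0 : 0 ≤ F := fun ω => Finset.sum_nonneg fun i _ => Finset.sum_nonneg fun j _ => by positivity
  have hsub : {ω | R + h ≤ matrixSpectralRadius (inhomogeneousMatrix b X ω)} ⊆
      {ω | (1 + h / R) ^ (2 * k) ≤ F ω} := by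
    intro ω hω
    have h1 := matrixSpectralRadius_pow_le hn (inhomogeneousMatrix b X ω)
      (Matrix.of (fun i j => (b' (i, j) : ℂ) * X ω i j)) d (fun i => (hd0 i).ne') hR (fun i j => by
        have hdC : (d i : ℂ) ≠ 0 := Complex.ofReal_ne_zero.2 (hd0 i).ne'
        have hRC : (R : ℂ) ≠ 0 := Complex.ofReal_ne_zero.2 hR.ne'
        simp only [inhomogeneousMatrix, Matrix.of_apply, hb']
        push_cast
        field_simp) k
    refine le_trans (pow_le_pow_left₀ (by positivity) ?_ _) h1
    rw [le_div_iff₀ hR, add_mul, one_mul, div_mul_cancel₀ _ hR.ne']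
    exact hω
  rw [le_div_iff₀ (by positivity), mul_comm]
  calc (1 + h / R) ^ (2 * k) * μ.real {ω | R + h ≤ matrixSpectralRadius (inhomogeneousMatrix b X ω)}
      ≤ (1 + h / R) ^ (2 * k) * μ.real {ω | (1 + h / R) ^ (2 * k) ≤ F ω} :=
        mul_le_mul_of_nonneg_left (measureReal_mono hsub) (by positivity)
    _ ≤ ∫ ω, F ω ∂μ := mul_meas_ge_le_integral_of_nonneg (Filter.Eventually.of_forall hF0) hfrob.1 _
    _ ≤ _ := hfrob.2

theorem theorem1p6 (K c C : ℝ) (hK : 0 < K) (hc : 0 < c) (hcC : c < C) :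
    ∃ C₀ C₁ : ℝ, 0 < C₀ ∧ 0 < C₁ ∧
      ∀ (n : ℕ) (_hn : 1 ≤ n) (Ω : Type*) [MeasurableSpace Ω] (μ : Measure Ω)
        [IsProbabilityMeasure μ] (X : Ω → Matrix (Fin n) (Fin n) ℂ)
        (_hX : IsSubexponentialModel μ K X)
        (b : Matrix (Fin n) (Fin n) ℝ) (_hb : ∀ i j, 0 ≤ b i j)
        (_hflat : ∀ i j, c / n ≤ b i j ^ 2 ∧ b i j ^ 2 ≤ C / n)
        (t : ℝ) (_ht : 0 < t),
        μ.real {ω | matrixSpectralRadius (inhomogeneousMatrix b X ω) ≥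
            √(realMatrixSpectralRadius (varianceMatrix b)) + t / √(n : ℝ)} ≤
          C₀ * (n : ℝ) ^ 2 * Real.exp (-(C₁ * t)) := by
  have hC : 0 < C := hc.trans hcC
  set D₀ := max 1 (K * Real.exp 1) with hD₀
  have hD1 : 1 ≤ D₀ := le_max_left _ _
  set D := 1728 * D₀ ^ 4 * (1 / √((c / C) ^ 3) + 1 + 6 * D₀) with hD
  have hD0 : 0 < D := by positivity
  have hsc : 0 < √c := Real.sqrt_pos.2 hc
  -- With this value, q = 4a√n R satisfies the size condition on the exponent with equality.
  set a := √c / (4 * C * D) with ha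
  have ha0 : 0 < a := by positivity
  refine ⟨(8 * a * √C + 5) * (2 * Real.exp 2) * Real.exp 1, a, by positivity, ha0, ?_⟩
  intro n hn Ω _ μ _ X hX b hb hflat t ht
  have hn0 : (0 : ℝ) < n := by exact_mod_cast hn
  have hn1 : (1 : ℝ) ≤ n := by exact_mod_cast hn
  have hsn : 0 < √(n : ℝ) := Real.sqrt_pos.2 hn0
  set ρ := realMatrixSpectralRadius (varianceMatrix b) with hρ
  have hρ0 : 0 ≤ ρ := ENNReal.toReal_nonneg
  have hρC : ρ ≤ C := realMatrixSpectralRadius_le hn fun i => by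
    calc ∑ j, |varianceMatrix b i j| ≤ ∑ _j : Fin n, C / n := Finset.sum_le_sum fun j _ => by
          simpa [varianceMatrix] using (hflat i j).2
      _ = C := by
          rw [Finset.sum_const, Finset.card_univ, Fintype.card_fin, nsmul_eq_mul]
          field_simp
  -- Half of the deviation goes into `R`, which gives ρ < R² strictly and h/R ≤ 1; the other half is
  -- left for Markov's inequality.
  set h := t / (2 * √(n : ℝ)) with hh
  have hh0 : 0 < h := by positivity
  set R := √ρ + h with hR
  have hR0 : 0 < R := by positivity
  have hRρ : ρ < R ^ 2 := by
    calc ρ = √ρ ^ 2 := (Real.sq_sqrt hρ0).symm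
      _ < R ^ 2 := pow_lt_pow_left₀ (by linarith) (Real.sqrt_nonneg _) (by norm_num)
  have hthr : √ρ + t / √(n : ℝ) = R + h := by rw [hR, hh]; ring
  set q := 4 * a * √(n : ℝ) * R with hq
  have hq0 : 0 < q := by positivity
  set k := ⌊q⌋₊ with hk
  have hkq : (k : ℝ) ≤ q := Nat.floor_le hq0.le
  have hqk : q ≤ k + 1 := (Nat.lt_floor_add_one q).le
  have hDk : D * (k * (C / (√c * √n * R))) ≤ 1 := by
    calc D * (k * (C / (√c * √n * R))) ≤ D * (q * (C / (√c * √n * R))) := by gcongr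
      _ = 1 := by rw [hq, ha]; field_simp
  have hP := measure_matrixSpectralRadius_ge_le hn hX hK hb hc hcC.le hflat hR0 hRρ hh0.le hD1
    (le_max_right _ _) k hDk
  have hset : {ω | matrixSpectralRadius (inhomogeneousMatrix b X ω) ≥ √ρ + t / √(n : ℝ)} =
      {ω | R + h ≤ matrixSpectralRadius (inhomogeneousMatrix b X ω)} := by rw [hthr]
  rw [hset]
  refine hP.trans ?_
  have hy1 : h / R ≤ 1 := by
    rw [div_le_one hR0, hR]; linarith [Real.sqrt_nonneg ρ]
  have hy0 : 0 ≤ h / R := by positivity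
  -- Here q·h/R = 2at, and rounding q down to `k` loses at most h/R ≤ 1; this is the origin of the
  -- factor e in the constant.
  have hyk : 2 * a * t - 1 ≤ (2 * k : ℕ) * (h / R / 2) := by
    have e1 : q * (h / R) = 2 * a * t := by rw [hq, hh]; field_simp; ring
    push_cast
    nlinarith
  have hexp : Real.exp (2 * a * t - 1) ≤ (1 + h / R) ^ (2 * k) := by
    calc Real.exp (2 * a * t - 1) ≤ Real.exp ((2 * k : ℕ) * (h / R / 2)) := Real.exp_le_exp.2 hyk
      _ = Real.exp (h / R / 2) ^ (2 * k) := Real.exp_nat_mul _ _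
      _ ≤ _ := by gcongr; exact exp_half_le_one_add hy0 hy1
  have hsnn : √(n : ℝ) ≤ n := by
    rw [Real.sqrt_le_left (by positivity)]; nlinarith
  -- The exponent `k` may grow with √n and with t. The former gives the second factor n; the latter
  -- is absorbed by e^{at}, half of the decay e^{-2at}.
  have hkn : 2 * (k : ℝ) + 1 ≤ n * ((8 * a * √C + 5) * Real.exp (a * t)) := by
    have h1 : q = 4 * a * √(n : ℝ) * √ρ + 2 * (a * t) := by rw [hq, hR, hh]; field_simp; ring
    have h2 : 4 * a * √(n : ℝ) * √ρ ≤ 4 * a * n * √C := by gcongr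
    have h3 := Real.add_one_le_exp (a * t)
    have h4 : 0 < a * t := by positivity
    have h5 : 1 ≤ Real.exp (a * t) := by linarith
    have h6 : 8 * a * n * √C ≤ n * (8 * a * √C) * Real.exp (a * t) := by
      calc 8 * a * n * √C = n * (8 * a * √C) * 1 := by ring
        _ ≤ _ := by gcongr
    have h7 : 4 * (a * t) + 1 ≤ n * (5 * Real.exp (a * t)) := by
      calc 4 * (a * t) + 1 ≤ 1 * (5 * Real.exp (a * t)) := by linarith
        _ ≤ _ := by gcongr
    calc 2 * (k : ℝ) + 1 ≤ 8 * a * n * √C + (4 * (a * t) + 1) := by linarith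
      _ ≤ n * (8 * a * √C) * Real.exp (a * t) + n * (5 * Real.exp (a * t)) := add_le_add h6 h7
      _ = _ := by ring
  rw [div_le_iff₀ (by positivity)]
  calc (n : ℝ) * ((2 * k + 1) * (2 * Real.exp 2))
      ≤ n * (n * ((8 * a * √C + 5) * Real.exp (a * t)) * (2 * Real.exp 2)) := by gcongr
    _ = (8 * a * √C + 5) * (2 * Real.exp 2) * Real.exp 1 * n ^ 2 * Real.exp (-(a * t)) *
        Real.exp (2 * a * t - 1) := by
        have : Real.exp (a * t) = Real.exp 1 * Real.exp (-(a * t)) * Real.exp (2 * a * t - 1) := by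
          rw [← Real.exp_add, ← Real.exp_add]; ring_nf
        rw [this]; ring
    _ ≤ _ := by gcongr
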